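/- Let $p$ be a prime number, let $R$ be a discrete valuation domain of characteristic $0$ with maximal ideal $pR$, and let $G$ be a finite cyclic $p$-group. A cohomological $G$-Mackey functor $\mathbf{X}$ with values in $R$-modules consists of $R$-modules $\mathbf{X}_U$ (one for each subgroup $U\le G$) and $R$-linear maps $i_{U,V}\colon \mathbf{X}_U\to\mathbf{X}_V$, $t_{V,U}\colon\mathbf{X}_V\to\mathbf{X}_U$ for $V\le U$ and $c_{g,U}\colon\mathbf{X}_U\to\mathbf{X}_{{}^gU}$ for $g\in G$, where ${}^gU=gUg^{-1}$ and $W^g=g^{-1}Wg$, such that: $i_{U,U}$, $t_{U,U}$ and $c_{u,U}$ for $u\in U$ are identity maps; $i_{V,W}\circ i_{U,V}=i_{U,W}$ and $t_{V,U}\circ t_{W,V}=t_{W,U}$ for $W\le V\le U$; $c_{h,{}^gU}\circ c_{g,U}=c_{hg,U}$; $i_{{}^gU,{}^gV}\circ c_{g,U}=c_{g,V}\circ i_{U,V}$ and $t_{{}^gV,{}^gU}\circ c_{g,V}=c_{g,U}\circ t_{V,U}$ for $V\le U$; $i_{U,W}\circ t_{V,U}=\sum_{g\in W\backslash U/V}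 t_{{}^gV\cap W,W}\circ c_{g,V\cap W^g}\circ i_{V,V\cap W^g}$ for $V,W\le U$; and $t_{V,U}\circ i_{U,V}=|U:V|\cdot\mathrm{id}_{\mathbf{X}_U}$ for $V\le U$. Homomorphisms are families of $R$-linear maps $\mathbf{X}_U\to\mathbf{Y}_U$ commuting with all $i$, $t$ and $c$. The trivial subgroup gives a left $R[G]$-module $\mathbf{X}_{\{1\}}$, with $g$ acting by $c_{g,\{1\}}$. The functor $\mathbf{X}$ has the Hilbert$^{90}$ property if * every map $i_{U,V}$, $V\le U$, is injective, and for all $V\trianglelefteq U\le G$ the image of $i_{U,V}$ is the module of $U/V$-invariants $(\mathbf{X}_V)^{U/V}$ (equivalently, $i$ induces an isomorphism from $\mathbf{X}$ to the functor $\mathbf{h}^0(\mathbf{X}_{\{1\}})$ defined below), and * $H^1(U,\mathbf{X}_{\{1\}})=0$ for every subgroup $U\le G$. For a left $R[G]$-module $M$, let $\mathbf{h}^0(M)$ be the cohomological $G$-Mackey functor with $\mathbf{h}^0(M)_U=M^U$, where $i_{U,V}\colon M^U\to M^V$ is the inclusion, $t_{V,U}\colon M^V\to M^U$ is $m\mapsto\sum_{r\in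 U/V} r m$, and $c_{g,U}\colon M^U\to M^{{}^gU}$ is multiplication by $g$. **Theorem.** Let $\mathbf{X}$ be a cohomological $G$-Mackey functor with the Hilbert$^{90}$ property such that every $\mathbf{X}_U$ is an $R$-lattice, i.e. a finitely generated projective $R$-module. Then there exists a finite $G$-set $\Omega$ such that $\mathbf{X}$ is isomorphic to $\mathbf{h}^0(R[\Omega])$, where $R[\Omega]$ is the permutation module of $\Omega$. In particular, $\mathbf{X}$ is a projective object of the category of all cohomological $G$-Mackey functors with values in $R$-modules. -/

import Mathlib

open CategoryTheory
open scoped Pointwise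

universe u v w

/-- For subgroups `W, V ≤ U`: the finite set `S ⊆ U` is a system of representatives for the
double cosets `W \ U / V`. -/
def IsDoubleCosetTransversal {G : Type v} [Group G] (S : Finset G) (W U V : Subgroup G) : Prop :=
  (∀ s ∈ S, s ∈ U) ∧ ∀ g ∈ U, ∃! s, s ∈ S ∧ ∃ x ∈ W, ∃ y ∈ V, g = x * s * y

theorem conj_smul_inf_conj_inv {G : Type v} [Group G] (g : G) (V W : Subgroup G) :
    MulAut.conj g • V ⊓ W = MulAut.conj g • (V ⊓ MulAut.conj g⁻¹ • W) := by
  rw [Subgroup.smul_inf, smul_smul, ← map_mul, mul_inv_cancel, map_one, one_smul]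

/-- A cohomological `G`-Mackey functor (for a finite group `G`) with values in `R`-modules.
Here `ᵍU = g U g⁻¹` is written `MulAut.conj g • U`, and for `V ≤ U`
* `res : X_U → X_V` is the restriction `i_{U,V}`,
* `tr : X_V → X_U` is the transfer `t_{V,U}`,
* `conj g : X_U → X_V` is the conjugation `c_{g,U}`, where the target is any subgroup `V`
  together with a proof that `V = ᵍU`; this avoids transport along equalities of subgroups. -/
structure CohMackeyFunctor (R : Type u) [CommRing R] (G : Type v) [Group G] where
  obj : Subgroup G → Type w
  [addCommGroup : ∀ U, AddCommGroup (obj U)]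
  [module : ∀ U, Module R (obj U)]
  res : ∀ {U V : Subgroup G}, V ≤ U → (obj U →ₗ[R] obj V)
  tr : ∀ {U V : Subgroup G}, V ≤ U → (obj V →ₗ[R] obj U)
  conj : ∀ (g : G) {U V : Subgroup G}, V = MulAut.conj g • U → (obj U →ₗ[R] obj V)
  res_self : ∀ (U : Subgroup G) (x : obj U), res (le_refl U) x = x
  tr_self : ∀ (U : Subgroup G) (x : obj U), tr (le_refl U) x = x
  conj_self : ∀ (U : Subgroup G) (g : G), g ∈ U → ∀ (h : U = MulAut.conj g • U) (x : obj U),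
    conj g h x = x
  res_res : ∀ {U V W : Subgroup G} (hVU : V ≤ U) (hWV : W ≤ V) (x : obj U),
    res hWV (res hVU x) = res (hWV.trans hVU) x
  tr_tr : ∀ {U V W : Subgroup G} (hVU : V ≤ U) (hWV : W ≤ V) (x : obj W),
    tr hVU (tr hWV x) = tr (hWV.trans hVU) x
  conj_conj : ∀ (g h : G) {U V W : Subgroup G} (hV : V = MulAut.conj g • U)
    (hW : W = MulAut.conj h • V) (hW' : W = MulAut.conj (h * g) • U) (x : obj U),
    conj h hW (conj g hV x) = conj (h * g) hW' x
  res_conj : ∀ (g : G) {U V U' V' : Subgroup G} (hVU : V ≤ U) (hU' : U' = MulAut.conj g • U)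
    (hV' : V' = MulAut.conj g • V) (hVU' : V' ≤ U') (x : obj U),
    res hVU' (conj g hU' x) = conj g hV' (res hVU x)
  tr_conj : ∀ (g : G) {U V U' V' : Subgroup G} (hVU : V ≤ U) (hU' : U' = MulAut.conj g • U)
    (hV' : V' = MulAut.conj g • V) (hVU' : V' ≤ U') (x : obj V),
    tr hVU' (conj g hV' x) = conj g hU' (tr hVU x)
  /-- The Mackey double coset formula. -/
  res_tr : ∀ {U V W : Subgroup G} (hVU : V ≤ U) (hWU : W ≤ U) (S : Finset G),
    IsDoubleCosetTransversal S W U V → ∀ x : obj V,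
    res hWU (tr hVU x) = ∑ g ∈ S,
      tr (inf_le_right : MulAut.conj g • V ⊓ W ≤ W)
        (conj g (conj_smul_inf_conj_inv g V W)
          (res (inf_le_left : V ⊓ MulAut.conj g⁻¹ • W ≤ V) x))
  tr_res : ∀ {U V : Subgroup G} (hVU : V ≤ U) (x : obj U),
    tr hVU (res hVU x) = V.relIndex U • x

namespace CohMackeyFunctor

attribute [instance] CohMackeyFunctor.addCommGroup CohMackeyFunctor.module

variable {R : Type u} [CommRing R] {G : Type v} [Group G]

/-- Homomorphisms of cohomological Mackey functors. -/
@[ext]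
structure Hom (X Y : CohMackeyFunctor.{u, v, w} R G) where
  app : ∀ U : Subgroup G, X.obj U →ₗ[R] Y.obj U
  app_res : ∀ {U V : Subgroup G} (h : V ≤ U) (x : X.obj U),
    app V (X.res h x) = Y.res h (app U x)
  app_tr : ∀ {U V : Subgroup G} (h : V ≤ U) (x : X.obj V),
    app U (X.tr h x) = Y.tr h (app V x)
  app_conj : ∀ (g : G) {U V : Subgroup G} (h : V = MulAut.conj g • U) (x : X.obj U),
    app V (X.conj g h x) = Y.conj g h (app U x)

/-- The category of cohomological `G`-Mackey functors with values in `R`-modules. -/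
instance : Category (CohMackeyFunctor.{u, v, w} R G) where
  Hom X Y := Hom X Y
  id X :=
    { app := fun _ => LinearMap.id
      app_res := fun _ _ => rfl
      app_tr := fun _ _ => rfl
      app_conj := fun _ _ _ _ _ => rfl }
  comp f g :=
    { app := fun U => (g.app U).comp (f.app U)
      app_res := fun h x => by simp [f.app_res, g.app_res]
      app_tr := fun h x => by simp [f.app_tr, g.app_tr]
      app_conj := fun a _ _ h x => by simp [f.app_conj, g.app_conj] }

/-- `X` takes values in `R`-lattices, i.e. in finitely generated projective `R`-modules. -/
def IsLatticeFunctor (X : CohMackeyFunctor.{u, v, w} R G) : Prop :=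
  ∀ U : Subgroup G, Module.Finite R (X.obj U) ∧ Module.Projective R (X.obj U)

theorem bot_eq_conj_smul_bot (g : G) : (⊥ : Subgroup G) = MulAut.conj g • (⊥ : Subgroup G) := by
  simp

/-- The value `X_{1}` at the trivial subgroup as a representation of `G`, where `g` acts by the
conjugation map `c_g`. -/
def toRep (X : CohMackeyFunctor.{u, v, w} R G) : Rep.{w} R G :=
  Rep.of (X := X.obj ⊥)
    { toFun := fun g => X.conj g (bot_eq_conj_smul_bot g)
      map_one' := LinearMap.ext fun x => X.conj_self ⊥ 1 (one_mem _) _ x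
      map_mul' := fun g h => LinearMap.ext fun x =>
        (X.conj_conj h g (bot_eq_conj_smul_bot h) (bot_eq_conj_smul_bot g) _ x).symm }

/-- All restriction maps are injective (equivalently, all section cohomology groups
`k⁰(U/V, X) = ker (i_{U,V})` vanish). -/
def IsInjective (X : CohMackeyFunctor.{u, v, w} R G) : Prop :=
  ∀ {U V : Subgroup G} (h : V ≤ U), Function.Injective (X.res h)

/-- `X` is of type `H⁰` (Galois descent): it is `i`-injective and
`k¹(U/V, X) = (X_V)^{U/V} / i_{U,V}(X_U)` vanishes for all `V` normal in `U`. -/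
def IsTypeH0 (X : CohMackeyFunctor.{u, v, w} R G) : Prop :=
  X.IsInjective ∧
    ∀ {U V : Subgroup G} (h : V ≤ U) (hn : ∀ g ∈ U, V = MulAut.conj g • V) (x : X.obj V),
      (∀ (g : G) (hg : g ∈ U), X.conj g (hn g hg) x = x) → ∃ y : X.obj U, X.res h y = x

/-- `X` has the Hilbert⁹⁰ property: it is of type `H⁰` and `H¹(U, X_{1}) = 0` for every
subgroup `U` of `G`. -/
def IsHilbert90 {R : Type u} [CommRing R] {G : Type u} [Group G]
    (X : CohMackeyFunctor.{u, u, u} R G) : Prop :=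
  X.IsTypeH0 ∧
    ∀ U : Subgroup G, Subsingleton (groupCohomology.H1 (Rep.res U.subtype X.toRep))

end CohMackeyFunctor

/-! ### The fixed point functor `h⁰(M)` -/

namespace FixedPointFunctor

/-- `f` is a system of representatives in `G` of the left cosets `U / V`. -/
def IsLeftTransversal {G : Type v} [Group G] {ι : Type*} (f : ι → G) (V U : Subgroup G) : Prop :=
  (∀ i, f i ∈ U) ∧ (∀ i j, (f i)⁻¹ * f j ∈ V → i = j) ∧ ∀ g ∈ U, ∃ i, (f i)⁻¹ * g ∈ V

section

variable {R : Type u} [CommRing R] {G : Type v} [Group G] (M : Rep.{w} R G)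

/-- The submodule `M^U` of `U`-invariants. -/
noncomputable abbrev fixed (U : Subgroup G) : Submodule R M :=
  Representation.invariants (M.ρ.comp U.subtype)

variable {M}

theorem mem_fixed {U : Subgroup G} {m : M} : m ∈ fixed M U ↔ ∀ g ∈ U, M.ρ g m = m := by
  simp [fixed, Representation.mem_invariants]

theorem rho_mul (g h : G) (m : M) : M.ρ (g * h) m = M.ρ g (M.ρ h m) := by
  rw [map_mul]; rfl

theorem sum_eq_sum {ι κ : Type*} [Fintype ι] [Fintype κ] {f : ι → G} {f' : κ → G}
    {V U : Subgroup G} (hf : IsLeftTransversal f V U) (hf' : IsLeftTransversal f' V U)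
    {m : M} (hm : m ∈ fixed M V) : ∑ i, M.ρ (f i) m = ∑ k, M.ρ (f' k) m := by
  choose e he using fun i => hf'.2.2 (f i) (hf.1 i)
  refine Fintype.sum_bijective e ⟨?_, ?_⟩ _ _ ?_
  · intro i j hij
    refine hf.2.1 i j ?_
    have h1 := he i
    have h2 := he j
    rw [← hij] at h2
    have h3 := V.mul_mem (V.inv_mem h1) h2
    simpa [mul_assoc] using h3
  · intro k
    obtain ⟨i, hi⟩ := hf.2.2 (f' k) (hf'.1 k)
    refine ⟨i, hf'.2.1 _ _ ?_⟩
    have h3 := V.mul_mem (he i) hi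
    simpa [mul_assoc] using h3
  · intro i
    have h1 := mem_fixed.1 hm _ (he i)
    calc M.ρ (f i) m = M.ρ (f' (e i) * ((f' (e i))⁻¹ * f i)) m := by rw [mul_inv_cancel_left]
      _ = M.ρ (f' (e i)) m := by rw [rho_mul, h1]

theorem out_isLeftTransversal {V U : Subgroup G} :
    IsLeftTransversal (fun q : U ⧸ V.subgroupOf U => ((Quotient.out q : U) : G)) V U := by
  refine ⟨fun q => (Quotient.out q : U).2, fun q r h => ?_, fun g hg => ?_⟩
  · have : (QuotientGroup.mk (Quotient.out q) : U ⧸ V.subgroupOf U)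
        = QuotientGroup.mk (Quotient.out r) := by
      rw [QuotientGroup.eq]; simpa [Subgroup.mem_subgroupOf] using h
    simpa using this
  · refine ⟨QuotientGroup.mk (⟨g, hg⟩ : U), ?_⟩
    have : (QuotientGroup.mk (Quotient.out (QuotientGroup.mk (⟨g, hg⟩ : U) :
        U ⧸ V.subgroupOf U)) : U ⧸ V.subgroupOf U) = QuotientGroup.mk (⟨g, hg⟩ : U) := by
      simp
    rw [QuotientGroup.eq] at this
    simpa [Subgroup.mem_subgroupOf] using this

theorem mem_conj_smul {g x : G} {U : Subgroup G} : x ∈ MulAut.conj g • U ↔ g⁻¹ * x * g ∈ U := by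
  rw [Subgroup.mem_pointwise_smul_iff_inv_smul_mem, ← map_inv, MulAut.smul_def,
    MulAut.conj_apply, inv_inv]

variable [Finite G]

noncomputable instance (V U : Subgroup G) : Fintype (U ⧸ V.subgroupOf U) := Fintype.ofFinite _

variable (M) in
/-- The transfer `M^V → M^U`, `m ↦ ∑ r • m`, where `r` runs over representatives of `U / V`. -/
noncomputable def transfer {U V : Subgroup G} (_h : V ≤ U) : fixed M V →ₗ[R] fixed M U where
  toFun m := ⟨∑ q : U ⧸ V.subgroupOf U, M.ρ ((Quotient.out q : U) : G) m.1, by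
    rw [mem_fixed]
    intro g hg
    rw [map_sum]
    simp_rw [← rho_mul]
    refine sum_eq_sum (V := V) (U := U) ?_ out_isLeftTransversal m.2
    obtain ⟨h1, h2, h3⟩ := out_isLeftTransversal (V := V) (U := U)
    refine ⟨fun q => U.mul_mem hg (h1 q), fun q r hqr => h2 q r ?_, fun x hx => ?_⟩
    · simpa [mul_assoc] using hqr
    · obtain ⟨i, hi⟩ := h3 (g⁻¹ * x) (U.mul_mem (U.inv_mem hg) hx)
      exact ⟨i, by simpa [mul_assoc] using hi⟩⟩
  map_add' m m' := Subtype.ext (by simp [Finset.sum_add_distrib])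
  map_smul' r m := Subtype.ext (by simp [Finset.smul_sum])

theorem transfer_eq {ι : Type*} [Fintype ι] {f : ι → G} {U V : Subgroup G} (h : V ≤ U)
    (hf : IsLeftTransversal f V U) (m : fixed M V) :
    (transfer M h m : M) = ∑ i, M.ρ (f i) m.1 :=
  sum_eq_sum out_isLeftTransversal hf m.2

variable (M) in
/-- Left multiplication by `g`, as a map `M^U → M^{gUg⁻¹}`. -/
noncomputable def conjMap (g : G) {U V : Subgroup G} (h : V = MulAut.conj g • U) :
    fixed M U →ₗ[R] fixed M V :=
  (M.ρ g).restrict fun m hm => by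
    rw [mem_fixed] at hm ⊢
    intro x hx
    rw [h, mem_conj_smul] at hx
    have := congrArg (M.ρ g) (hm _ hx)
    rw [← rho_mul] at this
    rw [← rho_mul, ← this]
    simp [mul_assoc]

end

/-- The cohomological Mackey functor `h⁰(M)` of invariants of an `R[G]`-module `M`. -/
noncomputable def h0 {R : Type u} [CommRing R] {G : Type v} [Group G] [Finite G]
    (M : Rep.{w} R G) : CohMackeyFunctor.{u, v, w} R G where
  obj U := fixed M U
  res h := Submodule.inclusion fun m hm => mem_fixed.2 fun g hg => mem_fixed.1 hm g (h hg)
  tr h := transfer M h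
  conj g _ _ h := conjMap M g h
  res_self _ _ := rfl
  tr_self U x := by
    apply Subtype.ext
    rw [transfer_eq (f := fun _ : Unit => (1 : G)) le_rfl]
    · simp
    · exact ⟨fun _ => U.one_mem, fun _ _ _ => rfl, fun g hg => ⟨(), by simp [hg]⟩⟩
  conj_self U g hg h x := Subtype.ext (mem_fixed.1 x.2 g hg)
  res_res _ _ _ := rfl
  tr_tr {U V W} hVU hWV x := by
    apply Subtype.ext
    rw [transfer_eq (f := fun q : (U ⧸ V.subgroupOf U) × (V ⧸ W.subgroupOf V) =>
      ((Quotient.out q.1 : U) : G) * ((Quotient.out q.2 : V) : G)) (hWV.trans hVU)]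
    · rw [Fintype.sum_prod_type, transfer_eq hVU out_isLeftTransversal]
      refine Finset.sum_congr rfl fun q _ => ?_
      rw [transfer_eq hWV out_isLeftTransversal, map_sum]
      exact Finset.sum_congr rfl fun r _ => (rho_mul _ _ _).symm
    · obtain ⟨h1, h2, h3⟩ := out_isLeftTransversal (V := V) (U := U)
      obtain ⟨k1, k2, k3⟩ := out_isLeftTransversal (V := W) (U := V)
      refine ⟨fun q => U.mul_mem (h1 _) (hVU (k1 _)), ?_, fun g hg => ?_⟩
      · rintro ⟨q, r⟩ ⟨q', r'⟩ h
        have hq : q = q' := by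
          refine h2 _ _ ?_
          have := V.mul_mem (V.mul_mem (k1 r) (hWV h)) (V.inv_mem (k1 r'))
          simpa [mul_assoc] using this
        subst hq
        have hr : r = r' := k2 _ _ (by simpa [mul_assoc] using h)
        rw [hr]
      · obtain ⟨q, hq⟩ := h3 g hg
        obtain ⟨r, hr⟩ := k3 _ hq
        exact ⟨(q, r), by simpa [mul_assoc] using hr⟩
  conj_conj g h _ _ _ _ _ _ x := Subtype.ext (rho_mul h g x.1).symm
  res_conj _ _ _ _ _ _ _ _ _ _ := rfl
  tr_conj g {U V U' V'} hVU hU' hV' hVU' x := by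
    apply Subtype.ext
    rw [transfer_eq (f := fun q : U ⧸ V.subgroupOf U => g * ((Quotient.out q : U) : G) * g⁻¹) hVU']
    · change _ = M.ρ g (transfer M hVU x : M)
      rw [transfer_eq hVU out_isLeftTransversal, map_sum]
      refine Finset.sum_congr rfl fun q _ => ?_
      change M.ρ _ (M.ρ g x.1) = _
      rw [← rho_mul, ← rho_mul]
      simp
    · obtain ⟨h1, h2, h3⟩ := out_isLeftTransversal (V := V) (U := U)
      subst hU' hV'
      refine ⟨fun q => ?_, fun q r h => h2 _ _ ?_, fun x hx => ?_⟩
      · rw [mem_conj_smul]; simp [mul_assoc]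
      · rw [mem_conj_smul] at h; simpa [mul_assoc] using h
      · rw [mem_conj_smul] at hx
        obtain ⟨i, hi⟩ := h3 _ hx
        refine ⟨i, ?_⟩
        rw [mem_conj_smul]; simpa [mul_assoc] using hi
  res_tr {U V W} hVU hWU S hS x := by
    apply Subtype.ext
    change (transfer M hVU x : M) = _
    rw [transfer_eq (f := fun q : (Σ s : S, W ⧸ (MulAut.conj s.1 • V ⊓ W).subgroupOf W) =>
      ((Quotient.out q.2 : W) : G) * q.1.1) hVU]
    · rw [Fintype.sum_sigma, AddSubmonoidClass.coe_finsetSum, ← Finset.sum_coe_sort S]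
      refine Finset.sum_congr rfl fun s _ => ?_
      rw [transfer_eq _ out_isLeftTransversal]
      exact Finset.sum_congr rfl fun r _ => rho_mul _ _ _
    · refine ⟨fun q => U.mul_mem (hWU (Quotient.out q.2 : W).2) (hS.1 _ q.1.2), ?_, fun g hg => ?_⟩
      · rintro ⟨⟨s, hs⟩, r⟩ ⟨⟨s', hs'⟩, r'⟩ h
        dsimp only at h
        have hss : s = s' := by
          refine (hS.2 s' (hS.1 _ hs')).unique ⟨hs, ((Quotient.out r' : W) : G)⁻¹ *
            ((Quotient.out r : W) : G), W.mul_mem (W.inv_mem (Quotient.out r' : W).2)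
            (Quotient.out r : W).2, _, h, ?_⟩ ⟨hs', 1, W.one_mem, 1, V.one_mem, by simp⟩
          simp [mul_assoc]
        subst hss
        have hr : r = r' := by
          refine (out_isLeftTransversal (V := MulAut.conj s • V ⊓ W) (U := W)).2.1 _ _ ?_
          refine ⟨?_, W.mul_mem (W.inv_mem (Quotient.out r : W).2) (Quotient.out r' : W).2⟩
          change _ ∈ MulAut.conj s • V
          rw [mem_conj_smul]
          simpa [mul_assoc] using h
        rw [hr]
      · obtain ⟨s, ⟨hs, a, ha, b, hb, rfl⟩, -⟩ := hS.2 g hg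
        obtain ⟨r, hr⟩ :=
          (out_isLeftTransversal (V := MulAut.conj s • V ⊓ W) (U := W)).2.2 a ha
        refine ⟨⟨⟨s, hs⟩, r⟩, ?_⟩
        have h1 : _ ∈ MulAut.conj s • V := hr.1
        rw [mem_conj_smul] at h1
        have := V.mul_mem h1 hb
        simpa [mul_assoc] using this
  tr_res {U V} hVU x := by
    apply Subtype.ext
    rw [transfer_eq hVU out_isLeftTransversal]
    change ∑ q : U ⧸ V.subgroupOf U, M.ρ ((Quotient.out q : U) : G) x.1 = _
    have h : ∀ q : U ⧸ V.subgroupOf U, M.ρ ((Quotient.out q : U) : G) x.1 = x.1 :=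
      fun q => mem_fixed.1 x.2 _ (Quotient.out q : U).2
    simp [h, Subgroup.relIndex, Subgroup.index, Nat.card_eq_fintype_card]

end FixedPointFunctor

/-! By descent, restriction to the trivial subgroup identifies X with h⁰(M), where M = X_{1}
(`IsTypeH0.nonempty_iso_h0`). So the point is that the lattice M has a basis permuted by G. Let σ
generate G and put x = σ - 1. The exact sequence 0 → M → M → M/pM → 0 and the vanishing of H¹(U, M)
show that U-fixed points of M/pM lift to U-fixed points of M.

Since x^{p^i} ≡ σ^{p^i} - 1 modulo p, x is nilpotent on M/pM, which is therefore a sum of Jordan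
blocks. The heart of the proof is that every nonzero block length is a power of p. For q = p^j, a
block of length strictly between q and pq would give a vector of ker x ∩ im x^q outside im x^{pq-1}.
This is excluded by `exists_pow_sub_mem_of_lift_fixed`: a lift fixed by σ^{pq} is corrected to a
vector fixed by σ^q, using that p lies in the ideal generated by x^{pq-q} and the norm P = (σ^{pq} -
1)/(σ^q - 1).

The generator of a block of length p^j is fixed by σ^{p^j} modulo p, hence lifts to a vector of M
fixed by σ^{p^j}. By Nakayama and a rank count, the σ-orbits of these lifts form a basis
(`exists_basis_of_lift_fixed`).

For projectivity, h⁰(R[Ω]) is freely generated by the elements a ∈ Ω placed at their stabilizers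
G_a: a morphism to Y is the same as an equivariant family y_a ∈ Y_{G_a} (`homOfFamily`,
`h0_hom_ext`). Epimorphisms are surjective on every subgroup, and equivariant families lift along
them. -/

/-! ### The norm polynomial and an ideal containing p. -/

section CyclotomicPolynomial

open Polynomial

/-- The polynomial `P = ∑_{i < p} (1 + X)^{qi}`, where `q` is a power of `p`, has constant term `p`,
and `p` lies in the ideal generated by `P` and `X^{pq-q}`. -/
theorem exists_geom_sum_polynomial {p : ℕ} (hp : p.Prime) (j : ℕ) :
    ∃ P w s r : ℤ[X], P * ((X + 1) ^ p ^ j - 1) = (X + 1) ^ p ^ (j + 1) - 1 ∧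
      P = (p : ℤ[X]) + X * w ∧ (p : ℤ[X]) = s * P + X ^ (p ^ (j + 1) - p ^ j) * r := by
  set q := p ^ j with hq
  have hle : q ≤ p ^ (j + 1) := Nat.pow_le_pow_right hp.pos (Nat.le_succ j)
  have hlt : q < p ^ (j + 1) := Nat.pow_lt_pow_right hp.one_lt (Nat.lt_succ_self j)
  set P : ℤ[X] := ∑ i ∈ Finset.range p, ((X + 1) ^ q) ^ i with hP
  have h1 : P * ((X + 1) ^ q - 1) = (X + 1) ^ p ^ (j + 1) - 1 := by
    rw [hP, geom_sum_mul, ← pow_mul, hq, ← pow_succ]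
  have h2 : X ∣ P - (p : ℤ[X]) := by
    rw [X_dvd_iff, coeff_zero_eq_eval_zero]
    simp [hP, eval_finsetSum]
  -- Modulo p, (X + 1)^{p^i} - 1 is X^{p^i}, so P reduces to X^{pq-q}. This is read off after
  -- multiplication by X^q, which the prime p does not divide.
  have h3 : (p : ℤ[X]) ∣ P - X ^ (p ^ (j + 1) - q) := by
    obtain ⟨a, ha⟩ := exists_add_pow_prime_pow_eq hp (X : ℤ[X]) 1 j
    obtain ⟨b, hb⟩ := exists_add_pow_prime_pow_eq hp (X : ℤ[X]) 1 (j + 1)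
    have key : (p : ℤ[X]) ∣ X ^ q * (P - X ^ (p ^ (j + 1) - q)) := by
      rw [mul_sub, ← pow_add, Nat.add_sub_cancel' hle]
      rw [ha, hb] at h1
      refine ⟨X * b - P * (X * a), ?_⟩
      simp only [one_pow, mul_one] at h1
      linear_combination h1
    have hpr : Prime (p : ℤ[X]) := by
      have := (Polynomial.prime_C_iff (R := ℤ)).2 (Nat.prime_iff_prime_int.1 hp)
      simpa using this
    refine (hpr.dvd_or_dvd key).resolve_left fun h => ?_
    have h4 : (C (p : ℤ)) ∣ (X : ℤ[X]) ^ q := by simpa using h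
    rw [C_dvd_iff_dvd_coeff] at h4
    have := h4 q
    rw [coeff_X_pow, if_pos rfl] at this
    exact (Nat.prime_iff_prime_int.1 hp).not_isUnit (isUnit_of_dvd_one this)
  obtain ⟨w, hw⟩ := h2
  obtain ⟨h, hh⟩ := h3
  -- Constant terms in P - X^{pq-q} = p h: as P(0) = p, h(0) = 1. Hence h is coprime to every power
  -- of X.
  have h5 : X ∣ h - 1 := by
    rw [X_dvd_iff]
    have e := congrArg (fun f => f.coeff 0) hh
    have e' := congrArg (fun f => f.coeff 0) hw
    have hp0 : (p : ℤ) ≠ 0 := by exact_mod_cast hp.ne_zero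
    simp only [coeff_zero_eq_eval_zero, eval_sub, eval_mul, eval_pow, eval_X, eval_natCast,
      zero_mul, eval_one, zero_pow (Nat.sub_pos_of_lt hlt).ne'] at e e' ⊢
    refine mul_left_cancel₀ hp0 ?_
    linear_combination e' - e
  obtain ⟨c, hc⟩ := h5
  have hco : IsCoprime h (X ^ (p ^ (j + 1) - q)) := by
    refine IsCoprime.pow_right ⟨1, -c, ?_⟩
    linear_combination hc
  obtain ⟨s, t, hst⟩ := hco
  -- Multiply s h + t X^{pq-q} = 1 by p and replace p h by P - X^{pq-q}.
  refine ⟨P, w, s, t * p - s, h1, by linear_combination hw, ?_⟩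
  linear_combination (-(p : ℤ[X])) * hst - s * hh

end CyclotomicPolynomial

/-! ### Excluding block lengths strictly between q and pq. -/

section NilpotentBlocks

open Polynomial

variable {M : Type*} [AddCommGroup M]

/-- If the fixed points of `σ^q` and `σ^{pq}`, where `q` is a power of `p`, lift from `M/pM` to `M`,
then `ker x ∩ im x^q ⊆ im x^{pq-1}` on `M/pM`, where `x = σ - 1`. -/
theorem exists_pow_sub_mem_of_lift_fixed {p : ℕ} (hp : p.Prime) (j : ℕ)
    (htf : ∀ m : M, p • m = 0 → m = 0) (σ : Module.End ℤ M)
    (H : ∀ i, i ≤ j + 1 → ∀ m b : M, (σ ^ p ^ i) m - m = p • b →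
      ∃ m' c, (σ ^ p ^ i) m' = m' ∧ m = m' + p • c)
    (a b : M) (hab : ((σ - 1) ^ (p ^ j + 1)) a = p • b) :
    ∃ c d, ((σ - 1) ^ p ^ j) a = ((σ - 1) ^ (p ^ (j + 1) - 1)) c + p • d := by
  set x := σ - 1 with hx
  have hσ : σ = x + 1 := by simp [hx]
  set ev : ℤ[X] → Module.End ℤ M := fun f => aeval x f with hev
  have evX : ∀ n, ev (X ^ n) = x ^ n := fun n => by simp [hev]
  have evm : ∀ f g m, ev (f * g) m = ev f (ev g m) := fun f g m => by simp [hev]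
  have evc : ∀ f g m, ev f (ev g m) = ev g (ev f m) := fun f g m => by
    rw [← evm, mul_comm, evm]
  have evp : ∀ m, ev (p : ℤ[X]) m = p • m := fun m => by simp [hev]
  have evs : ∀ n, ev ((X + 1) ^ n) = σ ^ n := fun n => by simp [hev, hσ]
  -- `x ^ q` and `σ ^ q - 1` agree modulo `p`
  have hmod : ∀ i, ∃ r : ℤ[X], ∀ m, (σ ^ p ^ i) m - m = (x ^ p ^ i) m + p • ev r m := fun i => by
    obtain ⟨r, hr⟩ := exists_add_pow_prime_pow_eq hp (X : ℤ[X]) 1 i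
    refine ⟨X * 1 * r, fun m => ?_⟩
    rw [← evs, hr, ← evp, ← evX, ← evm]
    simp only [hev, one_pow, mul_one, map_add, map_mul, map_one, LinearMap.add_apply,
      Module.End.mul_apply, Module.End.one_apply]
    abel
  have hlt : p ^ j < p ^ (j + 1) := Nat.pow_lt_pow_right hp.one_lt (Nat.lt_succ_self j)
  obtain ⟨P, w, s, r, h1, h2, h3⟩ := exists_geom_sum_polynomial hp j
  obtain ⟨r0, hr0⟩ := hmod j
  obtain ⟨r1, hr1⟩ := hmod (j + 1)
  have fixp : ∀ i m, (σ ^ p ^ i) (p • m) = p • m → (σ ^ p ^ i) m = m := fun i m h => by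
    rw [← sub_eq_zero] at h ⊢
    refine htf _ ?_
    rw [smul_sub, ← map_nsmul]
    exact h
  have fixev : ∀ i f m, (σ ^ p ^ i) m = m → (σ ^ p ^ i) (ev f m) = ev f m := fun i f m h => by
    rw [← evs, evc, evs, h]
  -- P acts as the norm: (σ^q - 1) P = σ^{pq} - 1 kills m.
  have fixP : ∀ m, (σ ^ p ^ (j + 1)) m = m → (σ ^ p ^ j) (ev P m) = ev P m := fun m h => by
    have := congrArg (fun f => ev f m) h1
    simp only [mul_comm P, evm] at this
    have h' : ((x + 1) ^ p ^ (j + 1)) m - m = 0 := by rw [← hσ, h, sub_self]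
    rw [← sub_eq_zero, hσ]
    simpa [hev, h'] using this
  have xap : ∀ n m, (x ^ n) m = ev (X ^ n) m := fun n m => by rw [evX]
  -- lift `a` to a fixed point `a'` of `σ ^ (p q)`
  obtain ⟨a', a'', ha', haa⟩ := H (j + 1) le_rfl a
    ((x ^ (p ^ (j + 1) - (p ^ j + 1))) b + ev r1 a) (by
      have e : p ^ (j + 1) - (p ^ j + 1) + (p ^ j + 1) = p ^ (j + 1) := by omega
      rw [hr1, smul_add, ← map_nsmul (x ^ _), ← hab, ← Module.End.mul_apply, ← pow_add, e])
  have hxa : (x ^ p ^ j) (x a') = p • (b - (x ^ (p ^ j + 1)) a'') := by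
    rw [← Module.End.mul_apply, ← pow_succ, smul_sub, ← hab, haa, map_add, map_nsmul]
    abel
  -- Modulo p, x^q kills x a', so x a' is fixed by σ^q there; lifting gives x a' = s' + p b' with s'
  -- fixed by σ^q.
  obtain ⟨s', b', hs', hxs⟩ := H j (Nat.le_succ j) (x a') (b - (x ^ (p ^ j + 1)) a'' + ev r0 (x a'))
    (by rw [hr0, hxa, smul_add])
  have fix_s : ∀ m, (σ ^ p ^ j) m = m → (σ ^ p ^ (j + 1)) m = m := fun m h => by
    rw [pow_succ, pow_mul]
    have : ∀ n : ℕ, ((σ ^ p ^ j) ^ n) m = m := fun n => by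
      induction n with
      | zero => simp
      | succ n ih => rw [pow_succ, Module.End.mul_apply, h, ih]
    exact this p
  have hx1 : ∀ m, x m = ev X m := fun m => by simp [hev]
  have hb' : (σ ^ p ^ (j + 1)) b' = b' := by
    refine fixp _ _ ?_
    have e : p • b' = x a' - s' := by rw [hxs]; abel
    rw [e, map_sub, hx1, fixev _ _ _ ha', fix_s _ hs']
  have hpb : p • b' = ev s (ev P b') + (x ^ (p ^ (j + 1) - p ^ j)) (ev r b') := by
    rw [← evp, h3]
    simp [hev]
  -- The correction removes the term x^{pq-q} r b' of p b' from x a', leaving x d = s' + s P b',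
  -- which is fixed by σ^q.
  set d := a' - (x ^ (p ^ (j + 1) - p ^ j - 1)) (ev r b') with hd
  have hd1 : (σ ^ p ^ (j + 1)) d = d := by
    rw [hd, map_sub, ha', xap, fixev _ _ _ (fixev _ _ _ hb')]
  have hxd : x d = s' + ev s (ev P b') := by
    have e : x ((x ^ (p ^ (j + 1) - p ^ j - 1)) (ev r b')) =
        (x ^ (p ^ (j + 1) - p ^ j)) (ev r b') := by
      rw [← Module.End.mul_apply, ← pow_succ']
      congr 2
      omega
    rw [hd, map_sub, e, hxs, hpb]
    abel
  -- From P = p + X w, p d = P d - w x d. Both terms are fixed by σ^q, and M has no p-torsion.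
  have hd2 : (σ ^ p ^ j) d = d := by
    refine fixp _ _ ?_
    have e : p • d = ev P d - ev w (x d) := by
      rw [h2, hx1, evc, ← evm]
      simp [hev]
    rw [e, map_sub, fixP _ hd1, fixev]
    rw [hxd, map_add, hs', fixev _ _ _ (fixP _ hb')]
  have hqd : (x ^ p ^ j) d = - (p • ev r0 d) := by
    rw [eq_neg_iff_add_eq_zero, ← hr0, hd2, sub_self]
  refine ⟨ev r b', (x ^ p ^ j) a'' - ev r0 d, ?_⟩
  have ea : a = d + (x ^ (p ^ (j + 1) - p ^ j - 1)) (ev r b') + p • a'' := by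
    rw [haa, hd]; abel
  have e : p ^ j + (p ^ (j + 1) - p ^ j - 1) = p ^ (j + 1) - 1 := by omega
  rw [ea, map_add, map_add, hqd, ← Module.End.mul_apply, ← pow_add, e, map_nsmul, smul_sub]
  abel

end NilpotentBlocks

/-! ### Jordan blocks of a nilpotent endomorphism. -/

section JordanBlocks

open Polynomial DirectSum

variable {k A : Type*} [Field k] [AddCommGroup A] [Module k A] [Module.Finite k A]

/-- A nilpotent endomorphism of a finite-dimensional vector space is a direct sum of Jordan blocks,
generated by vectors `a i` and of lengths `l i`. If every element of `ker y ∩ im y^q` lies in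
`im y^r`, then no block has a length `l` with `q < l ≤ r`. -/
theorem exists_jordan_generators (y : Module.End k A) {N : ℕ} (hy : y ^ N = 0) :
    ∃ (d : ℕ) (l : Fin d → ℕ) (a : Fin d → A), (∀ i, (y ^ l i) (a i) = 0) ∧
      ∑ i, l i = Module.finrank k A ∧
      (∀ W : Submodule k A, (∀ i, a i ∈ W) → (∀ w ∈ W, y w ∈ W) → W = ⊤) ∧
      ∀ q r, (∀ c, (y ^ (q + 1)) c = 0 → ∃ c', (y ^ q) c = (y ^ r) c') →
        ∀ i, q < l i → r < l i := by
  -- With X acting as y, the space is an X-power torsion k[X]-module, so the structure theorem over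
  -- a PID gives cyclic summands k[X]/(X^l).
  have htor : Module.IsTorsion' (Module.AEval' y) (Submonoid.powers (X : k[X])) := by
    intro z
    obtain ⟨m, rfl⟩ := (Module.AEval'.of y).surjective z
    refine ⟨⟨X ^ N, N, rfl⟩, ?_⟩
    have := Module.AEval'.X_pow_smul_of y m N
    rw [hy, zero_smul, map_zero] at this
    exact this
  obtain ⟨d, l, ⟨e⟩⟩ := Module.torsion_by_prime_power_decomposition
    (Polynomial.irreducible_X (R := k)) htor
  set o := Module.AEval'.of y
  have smul_o : ∀ n m, (X ^ n : k[X]) • o m = o ((y ^ n) m) := fun n m =>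
    Module.AEval'.X_pow_smul_of y m n
  let b : ∀ i, ⨁ i : Fin d, k[X] ⧸ Submodule.span k[X] {(X : k[X]) ^ l i} := fun i =>
    DirectSum.lof k[X] (Fin d) (fun i => k[X] ⧸ Submodule.span k[X] {(X : k[X]) ^ l i}) i
      (Submodule.Quotient.mk 1)
  have smul_b : ∀ (f : k[X]) i, f • b i = DirectSum.lof k[X] (Fin d)
      (fun i => k[X] ⧸ Submodule.span k[X] {(X : k[X]) ^ l i}) i (Submodule.Quotient.mk f) := by
    intro f i
    rw [← map_smul, ← Submodule.Quotient.mk_smul, smul_eq_mul, mul_one]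
  have hpow : ∀ n i, (y ^ n) (o.symm (e.symm (b i))) = o.symm (e.symm ((X ^ n : k[X]) • b i)) := by
    intro n i
    rw [map_smul]
    apply o.injective
    rw [← smul_o]
    simp
  refine ⟨d, l, fun i => o.symm (e.symm (b i)), fun i => ?_, ?_, fun W hW hyW => ?_, ?_⟩
  · rw [hpow, smul_b, (Submodule.Quotient.mk_eq_zero _).2 (Submodule.mem_span_singleton_self _)]
    simp
  · have : ∀ i, Module.Finite k (k[X] ⧸ Submodule.span k[X] {(X : k[X]) ^ l i}) := fun i =>
      (monic_X_pow (l i)).finite_quotient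
    have e' := o.trans (e.restrictScalars k)
    rw [e'.finrank_eq, Module.finrank_directSum]
    refine Finset.sum_congr rfl fun i _ => ?_
    have := finrank_quotient_span_eq_natDegree (K := k) (f := (X : k[X]) ^ l i)
    rw [natDegree_X_pow] at this
    exact this.symm
  · rw [eq_top_iff]
    rintro m -
    have hf : ∀ (f : k[X]) (w : A), w ∈ W → aeval y f w ∈ W := by
      intro f w hw
      induction f using Polynomial.induction_on' with
      | add f g hf hg => rw [map_add]; exact W.add_mem hf hg
      | monomial n c =>
        rw [aeval_monomial, Module.End.mul_apply, Module.algebraMap_end_apply]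
        refine W.smul_mem _ ?_
        induction n with
        | zero => simpa
        | succ n ih => rw [pow_succ', Module.End.mul_apply]; exact hyW _ ih
    obtain ⟨z, rfl⟩ : ∃ z, m = o.symm (e.symm z) := ⟨e (o m), by simp⟩
    induction z using DirectSum.induction_on with
    | zero => simp
    | add z z' h h' => rw [map_add, map_add]; exact W.add_mem h h'
    | of i z =>
      obtain ⟨f, rfl⟩ := Submodule.Quotient.mk_surjective _ z
      have := smul_b f i
      rw [DirectSum.lof_eq_of] at this
      rw [← this, map_smul]
      exact hf f _ (hW i)
  · intro q r h i hq
    by_contra! hr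
    -- If q < l ≤ r, this vector is sent by y^q to the last nonzero vector X^{l-1} of the block.
    -- Belonging to im y^r would force X^l to divide X^{l-1}.
    obtain ⟨c', hc'⟩ := h ((y ^ (l i - 1 - q)) (o.symm (e.symm (b i)))) (by
      rw [← Module.End.mul_apply, ← pow_add, show q + 1 + (l i - 1 - q) = l i by omega, hpow, smul_b,
        (Submodule.Quotient.mk_eq_zero _).2 (Submodule.mem_span_singleton_self _)]
      simp)
    rw [← Module.End.mul_apply, ← pow_add, show q + (l i - 1 - q) = l i - 1 by omega, hpow] at hc'
    have h1 : (X ^ (l i - 1) : k[X]) • b i = (X ^ r : k[X]) • e (o c') := by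
      rw [← map_smul e, smul_o, ← hc']
      simp
    have h2 := congrArg (fun z => z i) h1
    rw [smul_b] at h2
    simp only [DirectSum.smul_apply, DirectSum.lof_apply] at h2
    obtain ⟨f, hf⟩ := Submodule.Quotient.mk_surjective _ (e (o c') i)
    rw [← hf, ← Submodule.Quotient.mk_smul, Submodule.Quotient.eq, Ideal.submodule_span_eq,
      Ideal.mem_span_singleton, smul_eq_mul] at h2
    have h3 := (dvd_sub_left ((pow_dvd_pow X hr).mul_right f)).1 h2
    rw [X_pow_dvd_iff] at h3
    have := h3 (l i - 1) (by omega)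
    simp at this

end JordanBlocks

/-- With p^j the largest power of p not exceeding l > 0, p^j < l would give p^{j+1} ≤ l, against
maximality. -/
theorem eq_zero_or_eq_pow_of_gaps {p n l : ℕ} (hp : p.Prime) (hl : l ≤ p ^ n)
    (h : ∀ j < n, p ^ j < l → p ^ (j + 1) ≤ l) : l = 0 ∨ ∃ j ≤ n, l = p ^ j := by
  rcases Nat.eq_zero_or_pos l with h0 | h0
  · exact Or.inl h0
  · have h1 := Nat.pow_log_le_self p h0.ne'
    have h2 := Nat.lt_pow_succ_log_self hp.one_lt l
    have h3 : Nat.log p l ≤ n := (Nat.pow_le_pow_iff_right hp.one_lt).1 (h1.trans hl)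
    refine Or.inr ⟨_, h3, ?_⟩
    by_contra hne
    have h4 := lt_of_le_of_ne h1 (Ne.symm hne)
    have h5 : Nat.log p l < n := (Nat.pow_lt_pow_iff_right hp.one_lt).1 (h4.trans_le hl)
    exact absurd (h _ h5 h4) (not_le.2 h2)

/-! ### From Jordan blocks modulo p to a basis of orbits. -/

section PermutationBasis

open TensorProduct

variable {R : Type*} [CommRing R] [IsLocalRing R] {M : Type*} [AddCommGroup M] [Module R M]

theorem tmul_residueField_eq_zero_iff {p : ℕ}
    (hR : IsLocalRing.maximalIdeal R = Ideal.span {(p : R)}) (m : M) :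
    (1 : IsLocalRing.ResidueField R) ⊗ₜ[R] m = 0 ↔ ∃ b, m = p • b := by
  have h := (TensorProduct.quotTensorEquivQuotSMul M (IsLocalRing.maximalIdeal R)).map_eq_zero_iff
    (x := (1 : R ⧸ IsLocalRing.maximalIdeal R) ⊗ₜ[R] m)
  rw [TensorProduct.quotTensorEquivQuotSMul_mk_one_tmul, Submodule.Quotient.mk_eq_zero] at h
  refine h.symm.trans ?_
  rw [hR, Submodule.ideal_span_singleton_smul, Submodule.mem_smul_pointwise_iff_exists]
  constructor
  · rintro ⟨b, -, rfl⟩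
    exact ⟨b, by rw [Nat.cast_smul_eq_nsmul]⟩
  · rintro ⟨b, rfl⟩
    exact ⟨b, trivial, by rw [Nat.cast_smul_eq_nsmul]⟩

/-- Let `σ` be an endomorphism of a lattice with `σ^{p^n} = 1`, such that the fixed points of all
powers `σ^{p^i}` lift from `M/pM` to `M`. Then `M` has a basis made of finite `σ`-orbits. -/
theorem exists_basis_of_lift_fixed [IsDomain R] [Module.Free R M] [Module.Finite R M] {p n : ℕ}
    (hp : p.Prime) (hR : IsLocalRing.maximalIdeal R = Ideal.span {(p : R)}) (hp0 : (p : R) ≠ 0)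
    (σ : Module.End R M) (hσ : σ ^ p ^ n = 1)
    (H : ∀ i, i ≤ n → ∀ m b : M, (σ ^ p ^ i) m - m = p • b →
      ∃ m' c, (σ ^ p ^ i) m' = m' ∧ m = m' + p • c) :
    ∃ (ι : Type) (_ : Fintype ι) (v : Module.Basis ι R M), ∀ i, ∃ j, σ (v i) = v j := by
  set k := IsLocalRing.ResidueField R
  have htf : ∀ m : M, p • m = 0 → m = 0 := fun m hm => by
    rw [← Nat.cast_smul_eq_nsmul R] at hm
    exact (smul_eq_zero.1 hm).resolve_left hp0
  set x := σ - 1 with hx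
  set y : Module.End k (k ⊗[R] M) := x.baseChange k with hy
  have hyt : ∀ j m, (y ^ j) ((1 : k) ⊗ₜ[R] m) = 1 ⊗ₜ[R] (x ^ j) m := fun j m => by
    induction j with
    | zero => simp
    | succ j ih => rw [pow_succ', pow_succ', Module.End.mul_apply, ih]; simp [hy]
  have hsurj : ∀ z : k ⊗[R] M, ∃ m, (1 : k) ⊗ₜ[R] m = z :=
    TensorProduct.mk_surjective R M k Ideal.Quotient.mk_surjective
  have heq : ∀ m m' : M, (1 : k) ⊗ₜ[R] m = 1 ⊗ₜ[R] m' ↔ ∃ b, m = m' + p • b := fun m m' => by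
    rw [← sub_eq_zero, ← TensorProduct.tmul_sub, tmul_residueField_eq_zero_iff hR]
    simp only [sub_eq_iff_eq_add']
  have hmod : ∀ i m, ∃ b, (σ ^ p ^ i) m - m = (x ^ p ^ i) m + p • b := fun i m => by
    obtain ⟨r, hr⟩ := (Commute.one_right x).exists_add_pow_prime_pow_eq hp i
    refine ⟨(x * r) m, ?_⟩
    have e : σ = x + 1 := by simp [hx]
    rw [e, hr, one_pow, mul_one, mul_assoc]
    simp only [LinearMap.add_apply, Module.End.one_apply, Module.End.mul_apply,
      Module.End.natCast_apply]
    abel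
  have hyN : y ^ p ^ n = 0 := by
    refine LinearMap.ext fun z => ?_
    obtain ⟨m, rfl⟩ := hsurj z
    obtain ⟨b, hb⟩ := hmod n m
    rw [hσ, Module.End.one_apply, sub_self] at hb
    rw [hyt, LinearMap.zero_apply, tmul_residueField_eq_zero_iff hR]
    exact ⟨-b, by rw [smul_neg]; exact eq_neg_of_add_eq_zero_left hb.symm⟩
  obtain ⟨d, l, a, hl, hsum, hgen, hgap⟩ := exists_jordan_generators y hyN
  have hlpow : ∀ i, l i = 0 ∨ ∃ j ≤ n, l i = p ^ j := fun i => by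
    refine eq_zero_or_eq_pow_of_gaps hp ?_ fun j hj hji => ?_
    · by_contra! hlt
      -- As y^{p^n} = 0, the gap hypothesis holds for q = p^n and any r; r = l i bounds the length
      -- by p^n.
      exact lt_irrefl _ (hgap (p ^ n) (l i) (fun c _ => ⟨0, by simp [hyN]⟩) i hlt)
    · have hpos : 0 < p ^ (j + 1) := pow_pos hp.pos _
      have := hgap (p ^ j) (p ^ (j + 1) - 1) (fun z hz => ?_) i hji
      · omega
      obtain ⟨m, rfl⟩ := hsurj z
      rw [hyt, tmul_residueField_eq_zero_iff hR] at hz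
      obtain ⟨b, hb⟩ := hz
      have hpowZ : ∀ (τ : Module.End R M) (s : ℕ) (m : M),
          ((τ.restrictScalars ℤ) ^ s) m = (τ ^ s) m := fun τ s m => by
        simp [Module.End.pow_apply]
      obtain ⟨c, e, hce⟩ := exists_pow_sub_mem_of_lift_fixed hp j htf (σ.restrictScalars ℤ)
        (fun i hi m b h => by
          simp only [hpowZ] at h ⊢
          exact H i (hi.trans hj) m b h) m b (by
          have := hpowZ x (p ^ j + 1) m
          exact this.trans hb)
      refine ⟨1 ⊗ₜ c, ?_⟩
      rw [hyt, hyt, heq]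
      exact ⟨e, (hpowZ x _ m).symm.trans (hce.trans (congrArg (· + p • e) (hpowZ x _ c)))⟩
  -- The generator of a block of length p^j is killed by x^{p^j} modulo p, i.e. fixed there by
  -- σ^{p^j}. Empty blocks need no condition.
  have hlift : ∀ i, ∃ m, (1 : k) ⊗ₜ[R] m = a i ∧ (σ ^ l i) m = m := fun i => by
    obtain ⟨m, hm⟩ := hsurj (a i)
    rcases hlpow i with h0 | ⟨j, hj, hlj⟩
    · exact ⟨m, hm, by simp [h0]⟩
    · have h1 := hl i
      rw [← hm, hyt, hlj, tmul_residueField_eq_zero_iff hR] at h1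
      obtain ⟨b, hb⟩ := h1
      obtain ⟨b', hb'⟩ := hmod j m
      obtain ⟨m', c, h2, h3⟩ := H j hj m (b + b') (by rw [hb', hb, smul_add])
      refine ⟨m', ?_, by rw [hlj, h2]⟩
      rw [← hm, eq_comm, heq]
      exact ⟨c, h3⟩
  choose g hg hfix using hlift
  let v : (Σ i, Fin (l i)) → M := fun s => (σ ^ (s.2 : ℕ)) (g s.1)
  have hv : ∀ s, ∃ t, σ (v s) = v t := by
    rintro ⟨i, j⟩
    by_cases hj : (j : ℕ) + 1 < l i
    · exact ⟨⟨i, ⟨j + 1, hj⟩⟩, by simp only [v]; rw [pow_succ', Module.End.mul_apply]⟩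
    · have e : (j : ℕ) + 1 = l i := by omega
      refine ⟨⟨i, ⟨0, by omega⟩⟩, ?_⟩
      simp only [v]
      rw [← Module.End.mul_apply, ← pow_succ', e, hfix, pow_zero, Module.End.one_apply]
  -- Nakayama: the span modulo p contains the block generators and is y-stable, as y sends the image
  -- of v s to a difference of two such images.
  have hspan : Submodule.span R (Set.range v) = ⊤ := by
    rw [← IsLocalRing.map_tensorProduct_mk_eq_top, Submodule.map_span,
      ← Submodule.restrictScalars_span R k Ideal.Quotient.mk_surjective,
      Submodule.restrictScalars_eq_top_iff]
    set W := Submodule.span k (TensorProduct.mk R k M 1 '' Set.range v) with hW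
    have hWv : ∀ s, (1 : k) ⊗ₜ[R] v s ∈ W := fun s =>
      Submodule.subset_span ⟨_, ⟨s, rfl⟩, rfl⟩
    refine hgen W (fun i => ?_) fun w hw => ?_
    · rcases Nat.eq_zero_or_pos (l i) with h0 | h0
      · have := hl i
        rw [h0, pow_zero, Module.End.one_apply] at this
        rw [this]
        exact W.zero_mem
      · rw [← hg]
        simpa [v] using hWv ⟨i, ⟨0, h0⟩⟩
    · induction hw using Submodule.span_induction with
      | mem z hz =>
        obtain ⟨_, ⟨s, rfl⟩, rfl⟩ := hz
        obtain ⟨t, ht⟩ := hv s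
        have : y ((1 : k) ⊗ₜ[R] v s) = 1 ⊗ₜ v t - 1 ⊗ₜ v s := by
          simp [hy, hx, ht]
        exact this ▸ W.sub_mem (hWv t) (hWv s)
      | zero => rw [map_zero]; exact W.zero_mem
      | add z z' _ _ h h' => rw [map_add]; exact W.add_mem h h'
      | smul c z _ h => rw [map_smul]; exact W.smul_mem c h
  -- The block lengths sum to the dimension of M/pM, which is the rank of M, so the spanning family
  -- is a basis.
  refine ⟨_, inferInstance, basisOfTopLeSpanOfCardEqFinrank v hspan.ge ?_, fun s => ?_⟩
  · rw [Fintype.card_sigma]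
    simp only [Fintype.card_fin]
    rw [hsum]
    exact Module.finrank_baseChange
  · simpa using hv s

end PermutationBasis

/-! ### Vanishing of H¹ and lifting of fixed points. -/

section LiftFixed

open groupCohomology

variable {R : Type u} [CommRing R] {G : Type u} [Group G]

theorem exists_rho_sub_eq_of_subsingleton_H1 {A : Rep.{u} R G} (hA : Subsingleton (H1 A))
    (f : G → A) (hf : ∀ g h : G, f (g * h) = A.ρ g (f h) + f g) :
    ∃ a : A, ∀ g, A.ρ g a - a = f g := by
  have h := (H1π_eq_zero_iff (A := A) ⟨f, (mem_cocycles₁_iff f).2 hf⟩).1 (Subsingleton.elim _ _)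
  obtain ⟨a, ha⟩ := h
  exact ⟨a, fun g => congrFun ha g⟩

/-- If `H¹(G, A)` vanishes and `A` has no `p`-torsion, then the fixed points of `A/pA` lift. -/
theorem exists_fixed_add_of_subsingleton_H1 {A : Rep.{u} R G} (hA : Subsingleton (H1 A)) {p : ℕ}
    (htf : ∀ m : A, p • m = 0 → m = 0) (m : A) (hm : ∀ g, ∃ b : A, A.ρ g m - m = p • b) :
    ∃ m' c : A, (∀ g, A.ρ g m' = m') ∧ m = m' + p • c := by
  -- The coboundary g ↦ g m - m equals p f; without p-torsion f is itself a cocycle, hence g ↦ g a -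
  -- a for some a, and m - p a is fixed.
  choose f hf using hm
  obtain ⟨a, ha⟩ := exists_rho_sub_eq_of_subsingleton_H1 hA f fun g h => by
    rw [← sub_eq_zero]
    refine htf _ ?_
    rw [smul_sub, smul_add, ← map_nsmul (A.ρ g), ← hf, ← hf, ← hf, map_mul, Module.End.mul_apply,
      map_sub]
    abel
  refine ⟨m - p • a, a, fun g => ?_, by abel⟩
  have h1 := hf g
  rw [← ha, smul_sub, ← map_nsmul (A.ρ g)] at h1
  rw [map_sub, sub_eq_sub_iff_add_eq_add]
  rw [sub_eq_sub_iff_add_eq_add] at h1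
  rw [h1, add_comm]

/-- Let `G` be a finite cyclic `p`-group and `M` an `R[G]`-lattice with `H¹(U, M) = 0` for all
subgroups `U`. Then `G` permutes a basis of `M`. -/
theorem exists_permuted_basis [IsDomain R] [IsDiscreteValuationRing R]
    [CharZero R] {p : ℕ} (hp : p.Prime)
    (hR : IsLocalRing.maximalIdeal R = Ideal.span {(p : R)})
    [Finite G] [IsCyclic G] (hG : IsPGroup p G) (M : Rep.{u} R G)
    [Module.Finite R M] [Module.Free R M]
    (hM : ∀ U : Subgroup G, Subsingleton (H1 (Rep.res U.subtype M))) :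
    ∃ (ι : Type) (_ : Fintype ι) (v : Module.Basis ι R M), ∀ g i, ∃ j, M.ρ g (v i) = v j := by
  have : Fact p.Prime := ⟨hp⟩
  have hp0 : (p : R) ≠ 0 := Nat.cast_ne_zero.2 hp.ne_zero
  have htf : ∀ m : M, p • m = 0 → m = 0 := fun m hm => by
    rw [← Nat.cast_smul_eq_nsmul R] at hm
    exact (smul_eq_zero.1 hm).resolve_left hp0
  obtain ⟨n, hn⟩ := IsPGroup.iff_card.1 hG
  obtain ⟨g, hg⟩ := IsCyclic.exists_monoid_generator (α := G)
  obtain ⟨ι, hι, v, hv⟩ := exists_basis_of_lift_fixed hp hR hp0 (M.ρ g) (n := n)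
    (by rw [← map_pow, ← hn, pow_card_eq_one', map_one]) fun i _ m b hb => by
      rw [← map_pow] at hb ⊢
      obtain ⟨m', c, h1, h2⟩ := exists_fixed_add_of_subsingleton_H1
        (hM (Subgroup.zpowers (g ^ p ^ i))) htf m (by
          rintro ⟨u, hu⟩
          change ∃ b, M.ρ u m - m = p • b
          -- By finiteness u is a natural power of the generator, so congruence modulo p for the
          -- generator propagates by induction on the exponent.
          obtain ⟨k, rfl⟩ := mem_powers_iff_mem_zpowers.2 hu
          clear hu
          induction k with
          | zero => exact ⟨0, by simp⟩
          | succ k ih =>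
            obtain ⟨b', hb'⟩ := ih
            refine ⟨M.ρ (g ^ p ^ i) b' + b, ?_⟩
            dsimp only at hb' ⊢
            rw [pow_succ', map_mul, Module.End.mul_apply, smul_add, ← map_nsmul (M.ρ _), ← hb', ← hb,
              map_sub]
            abel)
      exact ⟨m', c, h1 ⟨_, Subgroup.mem_zpowers _⟩, h2⟩
  refine ⟨ι, hι, v, fun x i => ?_⟩
  obtain ⟨k, rfl⟩ := hg x
  induction k with
  | zero => exact ⟨i, by simp⟩
  | succ k ih =>
    obtain ⟨j, hj⟩ := ih
    obtain ⟨j', hj'⟩ := hv j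
    refine ⟨j', ?_⟩
    dsimp only at hj ⊢
    rw [pow_succ', map_mul, Module.End.mul_apply, hj, hj']

end LiftFixed

/-! ### Permuted bases and permutation modules. -/

section PermutedBasis

variable {R : Type u} [CommRing R] {G : Type v} [Group G]

theorem exists_mulAction_of_permuted_basis [Nontrivial R] {M : Rep.{w} R G} {ι : Type*}
    (v : Module.Basis ι R M) (hv : ∀ g i, ∃ j, M.ρ g (v i) = v j) :
    ∃ _ : MulAction G ι, ∀ (g : G) (i : ι), M.ρ g (v i) = v (g • i) := by
  choose a ha using hv
  have h1 : ∀ i, a 1 i = i := fun i => v.injective (by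
    rw [← ha, map_one, Module.End.one_apply])
  have h2 : ∀ g h i, a (g * h) i = a g (a h i) := fun g h i => v.injective (by
    rw [← ha, map_mul, Module.End.mul_apply, ha, ha])
  exact ⟨{ smul := a, one_smul := h1, mul_smul := h2 }, ha⟩

/-- A basis permuted by `G` identifies a representation with a permutation representation. -/
theorem exists_equivariant_equiv_ofMulAction {M : Rep.{w} R G} {Ω : Type*} [MulAction G Ω]
    (v : Module.Basis Ω R M) (hv : ∀ (g : G) (i : Ω), M.ρ g (v i) = v (g • i)) :
    ∃ e : M ≃ₗ[R] Rep.ofMulAction R G Ω, ∀ g m, e (M.ρ g m) = (Rep.ofMulAction R G Ω).ρ g (e m) := by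
  let e : M ≃ₗ[R] Rep.ofMulAction R G Ω :=
    v.repr.trans (MonoidAlgebra.coeffLinearEquiv R).symm
  have he : ∀ i, e (v i) = MonoidAlgebra.single i 1 := fun i => by simp [e]
  refine ⟨e, fun g m => ?_⟩
  have : e.toLinearMap ∘ₗ M.ρ g = (Rep.ofMulAction R G Ω).ρ g ∘ₗ e.toLinearMap :=
    v.ext fun i => by simp [hv, he]
  exact LinearMap.congr_fun this m

end PermutedBasis

/-! ### Descent: identifying X with h⁰(X_{1}). -/

namespace CohMackeyFunctor

variable {R : Type u} [CommRing R] {G : Type v} [Group G]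

/-- A homomorphism of Mackey functors which is bijective on all subgroups is an isomorphism. -/
noncomputable def isoOfBijective {X Y : CohMackeyFunctor.{u, v, w} R G} (f : Hom X Y)
    (hf : ∀ U, Function.Bijective (f.app U)) : X ≅ Y :=
  let e U := LinearEquiv.ofBijective (f.app U) (hf U)
  have he : ∀ U x, (e U).symm (f.app U x) = x := fun U x => (e U).symm_apply_apply x
  { hom := f
    inv :=
      { app := fun U => (e U).symm.toLinearMap
        app_res := fun {U V} h y => by
          obtain ⟨x, rfl⟩ := (hf U).2 y
          simp [he, ← f.app_res]
        app_tr := fun {U V} h y => by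
          obtain ⟨x, rfl⟩ := (hf V).2 y
          simp [he, ← f.app_tr]
        app_conj := fun g {U V} h y => by
          obtain ⟨x, rfl⟩ := (hf U).2 y
          simp [he, ← f.app_conj] }
    hom_inv_id := Hom.ext (funext fun U => LinearMap.ext fun x => (e U).symm_apply_apply x)
    inv_hom_id := Hom.ext (funext fun U => LinearMap.ext fun x => (e U).apply_symm_apply x) }

/-- Evaluates a summand of the Mackey formula for W = 1: all intersections are trivial, and only
conjugation by g survives. This makes restriction to 1 commute with transfers. -/
theorem tr_conj_res_bot (X : CohMackeyFunctor.{u, v, w} R G) (g : G) {V A B : Subgroup G}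
    (hA : A ≤ ⊥) (hAB : A = MulAut.conj g • B) (hB : B ≤ V) (x : X.obj V) :
    X.tr hA (X.conj g hAB (X.res hB x)) =
      X.conj g (bot_eq_conj_smul_bot g) (X.res bot_le x) := by
  obtain rfl := le_bot_iff.1 hA
  obtain rfl : B = ⊥ := by rw [← inv_smul_eq_iff.2 hAB]; simp
  exact X.tr_self _ _

variable [Finite G]

open FixedPointFunctor

/-- The homomorphism of fixed point functors induced by an equivariant linear map. -/
noncomputable def h0Map {M N : Rep.{w} R G} (e : M →ₗ[R] N)
    (he : ∀ g m, e (M.ρ g m) = N.ρ g (e m)) : Hom (h0 M) (h0 N) where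
  app U := e.restrict fun m hm => mem_fixed.2 fun g hg => by rw [← he, mem_fixed.1 hm g hg]
  app_res _ _ := rfl
  app_tr h x := Subtype.ext (by
    refine (congrArg e (transfer_eq h out_isLeftTransversal x)).trans ?_
    refine Eq.trans ?_ (transfer_eq (M := N) h out_isLeftTransversal _).symm
    rw [map_sum]
    exact Finset.sum_congr rfl fun q _ => he _ _)
  app_conj g _ _ _ x := Subtype.ext (he g x.1)

theorem nonempty_h0_iso {M N : Rep.{w} R G} (e : M ≃ₗ[R] N)
    (he : ∀ g m, e (M.ρ g m) = N.ρ g (e m)) : Nonempty (h0 M ≅ h0 N) := by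
  refine ⟨isoOfBijective (h0Map e.toLinearMap he) fun U => ⟨fun x y hxy => ?_, fun y => ?_⟩⟩
  · exact Subtype.ext (e.injective (congrArg Subtype.val hxy))
  · refine ⟨⟨e.symm y.1, mem_fixed.2 fun g hg => e.injective ?_⟩, Subtype.ext ?_⟩
    · rw [he, e.apply_symm_apply, mem_fixed.1 y.2 g hg]
    · exact e.apply_symm_apply y.1

/-- Representatives of the left cosets `U / V`, as a finite subset of `G`. -/
noncomputable def leftTransversalFinset (V U : Subgroup G) : Finset G :=
  Finset.univ.map ⟨fun q : U ⧸ V.subgroupOf U => ((Quotient.out q : U) : G), fun q r h =>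
    out_isLeftTransversal.2.1 q r (by
      change ((Quotient.out q : U) : G)⁻¹ * ((Quotient.out r : U) : G) ∈ V
      rw [show ((Quotient.out q : U) : G) = (Quotient.out r : U) from h, inv_mul_cancel]
      exact V.one_mem)⟩

theorem isDoubleCosetTransversal_bot (V U : Subgroup G) :
    IsDoubleCosetTransversal (leftTransversalFinset V U) ⊥ U V := by
  obtain ⟨h1, h2, h3⟩ := out_isLeftTransversal (V := V) (U := U)
  refine ⟨fun s hs => ?_, fun g hg => ?_⟩
  · obtain ⟨q, -, rfl⟩ := Finset.mem_map.1 hs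
    exact h1 q
  · obtain ⟨q, hq⟩ := h3 g hg
    refine ⟨_, ⟨Finset.mem_map_of_mem _ (Finset.mem_univ q), 1, Subgroup.one_mem _, _, hq, ?_⟩, ?_⟩
    · change g = 1 * ((Quotient.out q : U) : G) * (((Quotient.out q : U) : G)⁻¹ * g)
      simp
    · rintro s ⟨hs, x, hx, y, hy, rfl⟩
      obtain ⟨r, -, rfl⟩ := Finset.mem_map.1 hs
      rw [Subgroup.mem_bot] at hx
      subst hx
      have : q = r := by
        refine h2 q r ?_
        have hm : ((Quotient.out q : U) : G)⁻¹ * (1 * ((Quotient.out r : U) : G) * y) * y⁻¹ ∈ V :=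
          V.mul_mem hq (V.inv_mem hy)
        simpa [mul_assoc] using hm
      rw [this]

/-- Restriction to the trivial subgroup, as a homomorphism `X → h⁰(X_{1})`. -/
noncomputable def toH0 (X : CohMackeyFunctor.{u, v, w} R G) : Hom X (h0 X.toRep) where
  app U := (X.res bot_le).codRestrict (fixed X.toRep U) fun x => mem_fixed.2 fun g hg => by
    have hU : U = MulAut.conj g • U := (Subgroup.conj_smul_eq_self_of_mem hg).symm
    change X.conj g (bot_eq_conj_smul_bot g) (X.res bot_le x) = _
    rw [← X.res_conj g bot_le hU (bot_eq_conj_smul_bot g) bot_le, X.conj_self U g hg]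
    rfl
  app_res h x := Subtype.ext (X.res_res h bot_le x)
  app_tr {U V} h x := Subtype.ext (by
    refine (X.res_tr h bot_le _ (isDoubleCosetTransversal_bot V U) x).trans ?_
    rw [leftTransversalFinset, Finset.sum_map]
    refine Eq.trans (Finset.sum_congr rfl fun q _ => ?_)
      (transfer_eq (M := X.toRep) h out_isLeftTransversal _).symm
    exact X.tr_conj_res_bot _ _ _ _ x)
  app_conj g U V h x := Subtype.ext (X.res_conj g bot_le h (bot_eq_conj_smul_bot g) bot_le x)

theorem IsTypeH0.nonempty_iso_h0 {X : CohMackeyFunctor.{u, v, w} R G} (hX : X.IsTypeH0) :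
    Nonempty (X ≅ h0 X.toRep) := by
  refine ⟨isoOfBijective X.toH0 fun U => ⟨fun x y hxy => ?_, fun y => ?_⟩⟩
  · exact hX.1 bot_le (congrArg Subtype.val hxy)
  · obtain ⟨x, hx⟩ := hX.2 (bot_le : ⊥ ≤ U) (fun g _ => bot_eq_conj_smul_bot g) y.1
      fun g hg => mem_fixed.1 y.2 g hg
    exact ⟨x, Subtype.ext hx⟩

end CohMackeyFunctor

/-! ### Cokernels and epimorphisms. -/

namespace CohMackeyFunctor

section Cokernel

variable {R : Type u} [CommRing R] {G : Type v} [Group G]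

/-- The cokernel of a homomorphism of cohomological Mackey functors. -/
def cokernel {E B : CohMackeyFunctor.{u, v, w} R G} (f : Hom E B) :
    CohMackeyFunctor.{u, v, w} R G where
  obj U := B.obj U ⧸ LinearMap.range (f.app U)
  res h := Submodule.mapQ _ _ (B.res h) (by
    rintro _ ⟨x, rfl⟩
    exact ⟨E.res h x, f.app_res h x⟩)
  tr h := Submodule.mapQ _ _ (B.tr h) (by
    rintro _ ⟨x, rfl⟩
    exact ⟨E.tr h x, f.app_tr h x⟩)
  conj g _ _ h := Submodule.mapQ _ _ (B.conj g h) (by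
    rintro _ ⟨x, rfl⟩
    exact ⟨E.conj g h x, f.app_conj g h x⟩)
  res_self U x := by
    obtain ⟨x, rfl⟩ := Submodule.Quotient.mk_surjective _ x
    exact congrArg Submodule.Quotient.mk (B.res_self U x)
  tr_self U x := by
    obtain ⟨x, rfl⟩ := Submodule.Quotient.mk_surjective _ x
    exact congrArg Submodule.Quotient.mk (B.tr_self U x)
  conj_self U g hg h x := by
    obtain ⟨x, rfl⟩ := Submodule.Quotient.mk_surjective _ x
    exact congrArg Submodule.Quotient.mk (B.conj_self U g hg h x)
  res_res h h' x := by
    obtain ⟨x, rfl⟩ := Submodule.Quotient.mk_surjective _ x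
    exact congrArg Submodule.Quotient.mk (B.res_res h h' x)
  tr_tr h h' x := by
    obtain ⟨x, rfl⟩ := Submodule.Quotient.mk_surjective _ x
    exact congrArg Submodule.Quotient.mk (B.tr_tr h h' x)
  conj_conj g h _ _ _ hV hW hW' x := by
    obtain ⟨x, rfl⟩ := Submodule.Quotient.mk_surjective _ x
    exact congrArg Submodule.Quotient.mk (B.conj_conj g h hV hW hW' x)
  res_conj g _ _ _ _ h1 h2 h3 h4 x := by
    obtain ⟨x, rfl⟩ := Submodule.Quotient.mk_surjective _ x
    exact congrArg Submodule.Quotient.mk (B.res_conj g h1 h2 h3 h4 x)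
  tr_conj g _ _ _ _ h1 h2 h3 h4 x := by
    obtain ⟨x, rfl⟩ := Submodule.Quotient.mk_surjective _ x
    exact congrArg Submodule.Quotient.mk (B.tr_conj g h1 h2 h3 h4 x)
  res_tr {_ _ W} h1 h2 S hS x := by
    obtain ⟨x, rfl⟩ := Submodule.Quotient.mk_surjective _ x
    refine (congrArg (Submodule.mkQ (LinearMap.range (f.app W)))
      (B.res_tr h1 h2 S hS x)).trans ?_
    rw [map_sum]
    rfl
  tr_res h x := by
    obtain ⟨x, rfl⟩ := Submodule.Quotient.mk_surjective _ x
    exact congrArg Submodule.Quotient.mk (B.tr_res h x)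

/-- Epimorphisms of cohomological Mackey functors are surjective on all subgroups. -/
theorem app_surjective_of_epi {E B : CohMackeyFunctor.{u, v, w} R G} (f : E ⟶ B) [Epi f]
    (U : Subgroup G) : Function.Surjective (Hom.app f U) := by
  let π : B ⟶ cokernel f :=
    { app := fun U => Submodule.mkQ _
      app_res := fun _ _ => rfl
      app_tr := fun _ _ => rfl
      app_conj := fun _ _ _ _ _ => rfl : Hom B (cokernel f) }
  let z : B ⟶ cokernel f :=
    { app := fun U => 0
      app_res := fun _ _ => (map_zero _).symm
      app_tr := fun _ _ => (map_zero _).symm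
      app_conj := fun _ _ _ _ _ => (map_zero _).symm : Hom B (cokernel f) }
  have h : π = z := by
    rw [← cancel_epi f]
    refine Hom.ext (funext fun V => LinearMap.ext fun x => ?_)
    exact (Submodule.Quotient.mk_eq_zero _).2 ⟨x, rfl⟩
  intro b
  have hb : Submodule.mkQ (LinearMap.range (Hom.app f U)) b = 0 :=
    congrArg (fun k : Hom B (cokernel f) => k.app U b) h
  exact (Submodule.Quotient.mk_eq_zero _).1 hb

end Cokernel

/-! ### Orbit elements and their behaviour under res, tr and conj. -/

section OrbitElements

open MulAction

variable {R : Type u} [CommRing R] {G : Type v} [Group G] {Ω : Type*} [MulAction G Ω]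

theorem stabilizer_smul_eq_conj (g : G) (a : Ω) :
    stabilizer G (g • a) = MulAut.conj g • stabilizer G a :=
  stabilizer_smul_eq_stabilizer_map_conj g a

/-- The family `y` of elements of the `Y_{G_a}` is compatible with conjugation. -/
def IsEquivariantFamily (Y : CohMackeyFunctor.{u, v, w} R G)
    (y : ∀ a : Ω, Y.obj (stabilizer G a)) : Prop :=
  ∀ g a, Y.conj g (stabilizer_smul_eq_conj g a) (y a) = y (g • a)

/-- The element of `Y_V` obtained from `y a ∈ Y_{G_a}` by restriction to `V ∩ G_a` and transfer. -/
def orbitElement (Y : CohMackeyFunctor.{u, v, w} R G) (y : ∀ a : Ω, Y.obj (stabilizer G a))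
    (V : Subgroup G) (a : Ω) : Y.obj V :=
  Y.tr (inf_le_left : V ⊓ stabilizer G a ≤ V) (Y.res inf_le_right (y a))

variable {Y : CohMackeyFunctor.{u, v, w} R G} {y : ∀ a : Ω, Y.obj (stabilizer G a)}

theorem tr_res_congr {U V A B : Subgroup G} (h : A = B) (hAV : A ≤ V) (hBV : B ≤ V)
    (hAU : A ≤ U) (hBU : B ≤ U) (x : Y.obj U) :
    Y.tr hAV (Y.res hAU x) = Y.tr hBV (Y.res hBU x) := by
  subst h
  rfl

theorem orbitElement_stabilizer (a : Ω) : orbitElement Y y (stabilizer G a) a = y a := by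
  rw [orbitElement, tr_res_congr (inf_idem _) _ le_rfl _ le_rfl, Y.res_self, Y.tr_self]

theorem conj_orbitElement (hy : IsEquivariantFamily Y y) (g : G) {V V' : Subgroup G}
    (h : V' = MulAut.conj g • V) (a : Ω) :
    Y.conj g h (orbitElement Y y V a) = orbitElement Y y V' (g • a) := by
  have e : V' ⊓ stabilizer G (g • a) = MulAut.conj g • (V ⊓ stabilizer G a) := by
    rw [Subgroup.smul_inf, h, stabilizer_smul_eq_conj]
  rw [orbitElement, orbitElement, ← Y.tr_conj g inf_le_left h e inf_le_left,
    ← Y.res_conj g inf_le_right (stabilizer_smul_eq_conj g a) e inf_le_right, hy]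

theorem orbitElement_smul (hy : IsEquivariantFamily Y y) {V : Subgroup G} {g : G} (hg : g ∈ V)
    (a : Ω) : orbitElement Y y V (g • a) = orbitElement Y y V a := by
  have h : V = MulAut.conj g • V := (Subgroup.conj_smul_eq_self_of_mem hg).symm
  rw [← conj_orbitElement hy g h, Y.conj_self V g hg]

/-- The Mackey formula mirrors the splitting of the V-orbit of a into the W-orbits of the points s •
a, because conjugating V ∩ G_a by s ∈ V and intersecting with W gives W ∩ G_{sa}. -/
theorem res_orbitElement (hy : IsEquivariantFamily Y y) {V W : Subgroup G} (h : W ≤ V) (a : Ω)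
    (S : Finset G) (hS : IsDoubleCosetTransversal S W V (V ⊓ stabilizer G a)) :
    Y.res h (orbitElement Y y V a) = ∑ s ∈ S, orbitElement Y y W (s • a) := by
  rw [orbitElement, Y.res_tr inf_le_left h S hS]
  refine Finset.sum_congr rfl fun s hs => ?_
  have e : MulAut.conj s • (V ⊓ stabilizer G a) ⊓ W = W ⊓ stabilizer G (s • a) := by
    rw [Subgroup.smul_inf, ← stabilizer_smul_eq_conj,
      Subgroup.conj_smul_eq_self_of_mem (hS.1 s hs), inf_comm, ← inf_assoc, inf_eq_left.2 h]
  rw [Y.res_res, ← Y.res_conj s _ (stabilizer_smul_eq_conj s a) _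
    (e.le.trans inf_le_right), hy, orbitElement]
  exact tr_res_congr e _ _ _ _ _

/-- The cohomological axiom enters here: transferring through V ∩ G_a produces the index as a
scalar. -/
theorem tr_orbitElement {V W : Subgroup G} (h : W ≤ V) (a : Ω) :
    Y.tr h (orbitElement Y y W a) =
      (W ⊓ stabilizer G a).relIndex (V ⊓ stabilizer G a) • orbitElement Y y V a := by
  have e : W ⊓ stabilizer G a ≤ V ⊓ stabilizer G a := inf_le_inf_right _ h
  rw [orbitElement, Y.tr_tr, ← Y.tr_tr inf_le_left e, ← Y.res_res inf_le_right e, Y.tr_res,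
    map_nsmul, orbitElement]

theorem Hom.app_orbitElement {X : CohMackeyFunctor.{u, v, w} R G} (f : Hom X Y)
    (x : ∀ a : Ω, X.obj (stabilizer G a)) (V : Subgroup G) (a : Ω) :
    f.app V (orbitElement X x V a) = orbitElement Y (fun a => f.app _ (x a)) V a := by
  rw [orbitElement, f.app_tr, f.app_res, orbitElement]

theorem mem_orbit_out_iff {V : Subgroup G} (b : Ω) (o : orbitRel.Quotient V Ω) :
    b ∈ orbit V (Quotient.out o) ↔ Quotient.mk (orbitRel V Ω) b = o := by
  constructor
  · intro h
    rw [← Quotient.out_eq o]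
    exact Quotient.sound (s := orbitRel V Ω) h
  · rintro rfl
    exact (orbitRel V Ω).symm (Quotient.mk_out (s := orbitRel V Ω) b)

theorem exists_isDoubleCosetTransversal [Finite G] {W U V : Subgroup G} (hW : W ≤ U) (hV : V ≤ U) :
    ∃ S, IsDoubleCosetTransversal S W U V := by
  classical
  have := Fintype.ofFinite G
  let r := DoubleCoset.setoid (W : Set G) (V : Set G)
  have hr : ∀ g, ∃ x ∈ W, ∃ y ∈ V, g = x * (Quotient.mk r g).out * y := fun g =>
    DoubleCoset.rel_iff.1 (Quotient.mk_out (s := r) g)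
  refine ⟨Finset.univ.filter fun s => s ∈ U ∧ (Quotient.mk r s).out = s, ?_, fun g hg => ?_⟩
  · intro s hs
    exact (Finset.mem_filter.1 hs).2.1
  · obtain ⟨x, hx, y, hy, h⟩ := hr g
    refine ⟨(Quotient.mk r g).out, ⟨?_, x, hx, y, hy, h⟩, ?_⟩
    · simp only [Finset.mem_filter, Finset.mem_univ, true_and, Quotient.out_eq, and_true]
      have e : (Quotient.mk r g).out = x⁻¹ * g * y⁻¹ := by
        rw [eq_mul_inv_iff_mul_eq, eq_inv_mul_iff_mul_eq, ← mul_assoc]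
        exact h.symm
      rw [e]
      exact U.mul_mem (U.mul_mem (U.inv_mem (hW hx)) hg) (U.inv_mem (hV hy))
    · rintro s ⟨hs, x', hx', y', hy', h'⟩
      obtain ⟨-, -, hs⟩ := Finset.mem_filter.1 hs
      rw [← hs]
      congr 1
      exact Quotient.sound (s := r) (DoubleCoset.rel_iff.2 ⟨x', hx', y', hy', h'⟩)

end OrbitElements

end CohMackeyFunctor

namespace CohMackeyFunctor

/-! ### Universal property of h⁰(R[Ω]). -/

section Permutation

open MulAction FixedPointFunctor

variable {R : Type u} [CommRing R] {G : Type v} [Group G] [Finite G] {Ω : Type w} [MulAction G Ω]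

variable (R) in
/-- The basis element `a ∈ Ω` of `R[Ω]`, as an element of `h⁰(R[Ω])` at the stabilizer of `a`. -/
noncomputable def basisElement (a : Ω) :
    (h0 (Rep.ofMulAction R G Ω)).obj (stabilizer G a) :=
  ⟨MonoidAlgebra.single a 1, mem_fixed.2 fun g hg => by
    refine (Representation.ofMulAction_single g a (1 : R)).trans ?_
    rw [mem_stabilizer_iff.1 hg]⟩

theorem isEquivariantFamily_basisElement :
    IsEquivariantFamily (h0 (Rep.ofMulAction R G Ω)) (basisElement R) := fun g a =>
  Subtype.ext (Representation.ofMulAction_single g a (1 : R))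

/-- The coefficient at `b` of an element of `h⁰(R[Ω])_V`. -/
noncomputable def coeffAt (V : Subgroup G) (b : Ω) :
    (h0 (Rep.ofMulAction R G Ω)).obj V →ₗ[R] R :=
  (Finsupp.lapply b).comp ((MonoidAlgebra.coeffLinearEquiv R).toLinearMap.comp
    (fixed (Rep.ofMulAction R G Ω) V).subtype)

theorem coeffAt_ext {V : Subgroup G} {m m' : (h0 (Rep.ofMulAction R G Ω)).obj V}
    (h : ∀ b, coeffAt V b m = coeffAt V b m') : m = m' :=
  Subtype.ext ((MonoidAlgebra.coeffLinearEquiv R).injective (Finsupp.ext h))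

theorem coeffAt_smul {V : Subgroup G} {g : G} (hg : g ∈ V) (b : Ω)
    (m : (h0 (Rep.ofMulAction R G Ω)).obj V) : coeffAt V (g • b) m = coeffAt V b m := by
  have h := mem_fixed.1 m.2 g hg
  have h' := Representation.coeff_ofMulAction (k := R) g m.1 (g • b)
  rw [inv_smul_smul] at h'
  exact (congrArg (fun f : MonoidAlgebra R Ω => f.coeff (g • b)) h).symm.trans h'

open Classical in
-- The transfer sums over V/(V ∩ G_a), which meets each point of the V-orbit of a exactly once.
-- Orbit sums thus form a basis of the V-invariants.
theorem coeffAt_orbitElement (V : Subgroup G) (a b : Ω) :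
    coeffAt V b (orbitElement (h0 (Rep.ofMulAction R G Ω)) (basisElement R) V a) =
      if b ∈ orbit V a then 1 else 0 := by
  have h1 : (orbitElement (h0 (Rep.ofMulAction R G Ω)) (basisElement R) V a).1 =
      ∑ q : V ⧸ (V ⊓ stabilizer G a).subgroupOf V,
        MonoidAlgebra.single (((Quotient.out q : V) : G) • a) (1 : R) :=
    (transfer_eq (M := Rep.ofMulAction R G Ω) inf_le_left out_isLeftTransversal _).trans
      (Finset.sum_congr rfl fun q _ => Representation.ofMulAction_single _ a (1 : R))
  have h2 : coeffAt V b (orbitElement (h0 (Rep.ofMulAction R G Ω)) (basisElement R) V a) =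
      ∑ q : V ⧸ (V ⊓ stabilizer G a).subgroupOf V,
        if ((Quotient.out q : V) : G) • a = b then 1 else 0 := by
    refine (congrArg (fun f : MonoidAlgebra R Ω => f.coeff b) h1).trans ?_
    simp [MonoidAlgebra.coeff_sum, Finsupp.single_apply]
  rw [h2]
  obtain ⟨k1, k2, k3⟩ := out_isLeftTransversal (V := V ⊓ stabilizer G a) (U := V)
  split_ifs with hb
  · obtain ⟨⟨v, hv⟩, rfl⟩ := hb
    obtain ⟨q, hq⟩ := k3 v hv
    have hqv : ((Quotient.out q : V) : G) • a = v • a := by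
      have := mem_stabilizer_iff.1 hq.2
      rw [mul_smul, inv_smul_eq_iff] at this
      exact this.symm
    rw [Finset.sum_eq_single q]
    · exact if_pos hqv
    · intro r _ hr
      refine if_neg fun hra => hr (k2 r q ⟨V.mul_mem (V.inv_mem (k1 r)) (k1 q), ?_⟩)
      refine mem_stabilizer_iff.2 ?_
      rw [mul_smul, inv_smul_eq_iff]
      exact hqv.trans hra.symm
    · exact fun h => absurd (Finset.mem_univ q) h
  · refine Finset.sum_eq_zero fun q _ => if_neg fun h => hb ?_
    exact ⟨⟨_, k1 q⟩, h⟩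

variable [∀ V : Subgroup G, Fintype (orbitRel.Quotient V Ω)]

/-- Every element of `h⁰(R[Ω])_V` is a linear combination of orbit elements. -/
theorem sum_coeffAt_smul_orbitElement {V : Subgroup G} (m : (h0 (Rep.ofMulAction R G Ω)).obj V) :
    ∑ o : orbitRel.Quotient V Ω, coeffAt V (Quotient.out o) m •
      orbitElement (h0 (Rep.ofMulAction R G Ω)) (basisElement R) V (Quotient.out o) = m := by
  classical
  refine coeffAt_ext fun b => ?_
  rw [map_sum]
  simp only [map_smul, coeffAt_orbitElement, mem_orbit_out_iff, smul_eq_mul, mul_ite, mul_one,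
    mul_zero, Finset.sum_ite_eq, Finset.mem_univ, if_true]
  obtain ⟨⟨g, hg⟩, h⟩ := (mem_orbit_out_iff b (Quotient.mk (orbitRel V Ω) b)).2 rfl
  exact (coeffAt_smul hg (Quotient.out (Quotient.mk (orbitRel V Ω) b)) m).symm.trans
    (congrArg (fun c => coeffAt V c m) h)

theorem h0_hom_ext {Y : CohMackeyFunctor.{u, v, max u w} R G} {f f' : Hom (h0 (Rep.ofMulAction R G Ω)) Y}
    (h : ∀ a, f.app _ (basisElement R a) = f'.app _ (basisElement R a)) : f = f' := by
  refine Hom.ext (funext fun V => LinearMap.ext fun m => ?_)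
  rw [← sum_coeffAt_smul_orbitElement m]
  simp only [map_sum, map_smul, Hom.app_orbitElement, h]

/-- The linear map `h⁰(R[Ω])_V → Y_V` sending the orbit elements of `h⁰(R[Ω])` to those of `Y`. -/
noncomputable def evalAt (Y : CohMackeyFunctor.{u, v, max u w} R G)
    (y : ∀ a : Ω, Y.obj (stabilizer G a)) (V : Subgroup G) :
    (h0 (Rep.ofMulAction R G Ω)).obj V →ₗ[R] Y.obj V :=
  ∑ o : orbitRel.Quotient V Ω,
    (coeffAt V (Quotient.out o)).smulRight (orbitElement Y y V (Quotient.out o))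

theorem evalAt_orbitElement {Y : CohMackeyFunctor.{u, v, max u w} R G}
    {y : ∀ a : Ω, Y.obj (stabilizer G a)} (hy : IsEquivariantFamily Y y) (V : Subgroup G) (a : Ω) :
    evalAt Y y V (orbitElement (h0 (Rep.ofMulAction R G Ω)) (basisElement R) V a) =
      orbitElement Y y V a := by
  classical
  have h : ∀ o : orbitRel.Quotient V Ω, Quotient.out o ∈ orbit V a ↔
      Quotient.mk (orbitRel V Ω) a = o := fun o => by
    rw [← mem_orbit_out_iff, mem_orbit_symm]
  simp only [evalAt, LinearMap.sum_apply, LinearMap.smulRight_apply, coeffAt_orbitElement, h,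
    ite_smul, one_smul, zero_smul, Finset.sum_ite_eq, Finset.mem_univ, if_true]
  obtain ⟨⟨g, hg⟩, h⟩ := (mem_orbit_out_iff a (Quotient.mk (orbitRel V Ω) a)).2 rfl
  conv_rhs => rw [← h]
  exact (orbitElement_smul hy hg _).symm

theorem h0_induction {V : Subgroup G} {P : (h0 (Rep.ofMulAction R G Ω)).obj V → Prop}
    (m : (h0 (Rep.ofMulAction R G Ω)).obj V)
    (orb : ∀ a, P (orbitElement (h0 (Rep.ofMulAction R G Ω)) (basisElement R) V a))
    (zero : P 0) (add : ∀ x y, P x → P y → P (x + y)) (smul : ∀ (r : R) x, P x → P (r • x)) :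
    P m := by
  rw [← sum_coeffAt_smul_orbitElement m]
  exact Finset.sum_induction _ P add zero fun o _ => smul _ _ (orb _)

/-- The homomorphism `h⁰(R[Ω]) → Y` given by an equivariant family. -/
noncomputable def homOfFamily (Y : CohMackeyFunctor.{u, v, max u w} R G)
    (y : ∀ a : Ω, Y.obj (stabilizer G a)) (hy : IsEquivariantFamily Y y) :
    Hom (h0 (Rep.ofMulAction R G Ω)) Y where
  app V := evalAt Y y V
  app_res {U V} h m := by
    induction m using h0_induction with
    | orb a =>
      obtain ⟨S, hS⟩ := exists_isDoubleCosetTransversal h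
        (inf_le_left : U ⊓ stabilizer G a ≤ U)
      rw [res_orbitElement isEquivariantFamily_basisElement h a S hS, map_sum,
        evalAt_orbitElement hy, res_orbitElement hy h a S hS]
      exact Finset.sum_congr rfl fun s _ => evalAt_orbitElement hy V _
    | zero => simp only [map_zero]
    | add x y hx hy => simp only [map_add, hx, hy]
    | smul r x hx => simp only [map_smul, hx]
  app_tr {U V} h m := by
    induction m using h0_induction with
    | orb a =>
      rw [tr_orbitElement, map_nsmul, evalAt_orbitElement hy, evalAt_orbitElement hy,
        tr_orbitElement]
    | zero => simp only [map_zero]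
    | add x y hx hy => simp only [map_add, hx, hy]
    | smul r x hx => simp only [map_smul, hx]
  app_conj g U V h m := by
    induction m using h0_induction with
    | orb a =>
      rw [conj_orbitElement isEquivariantFamily_basisElement, evalAt_orbitElement hy,
        evalAt_orbitElement hy, conj_orbitElement hy]
    | zero => simp only [map_zero]
    | add x y hx hy => simp only [map_add, hx, hy]
    | smul r x hx => simp only [map_smul, hx]

theorem homOfFamily_basisElement {Y : CohMackeyFunctor.{u, v, max u w} R G}
    {y : ∀ a : Ω, Y.obj (stabilizer G a)} (hy : IsEquivariantFamily Y y) (a : Ω) :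
    (homOfFamily Y y hy).app _ (basisElement R a) = y a := by
  rw [← orbitElement_stabilizer (Y := h0 (Rep.ofMulAction R G Ω)) (y := basisElement R) a]
  exact (evalAt_orbitElement hy _ a).trans (orbitElement_stabilizer a)

end Permutation

/-! ### Lifting equivariant families and projectivity. -/

section Projective

open MulAction FixedPointFunctor

variable {R : Type u} [CommRing R] {G : Type v} [Group G] {Ω : Type*} [MulAction G Ω]

/-- Equivariant families lift along surjective homomorphisms. -/
theorem IsEquivariantFamily.exists_lift {E B : CohMackeyFunctor.{u, v, w} R G} (e : Hom E B)
    (he : ∀ U, Function.Surjective (e.app U)) {b : ∀ a : Ω, B.obj (stabilizer G a)}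
    (hb : IsEquivariantFamily B b) :
    ∃ z : ∀ a : Ω, E.obj (stabilizer G a), IsEquivariantFamily E z ∧ ∀ a, e.app _ (z a) = b a := by
  choose z hz using fun a : Ω => he _ (b a)
  have hout : ∀ a : Ω, ∃ g : G, g • Quotient.out (Quotient.mk (orbitRel G Ω) a) = a := fun a => by
    obtain ⟨g, hg⟩ := Quotient.mk_out (s := orbitRel G Ω) a
    exact ⟨g⁻¹, by rw [inv_smul_eq_iff]; exact hg.symm⟩
  choose c hc using hout
  have hst : ∀ a a' : Ω, ∀ g : G, g • a = a' → stabilizer G a' = MulAut.conj g • stabilizer G a :=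
    fun a a' g h => h ▸ stabilizer_smul_eq_conj g a
  -- Transporting a chosen lift from an orbit representative to a does not depend on the group
  -- element: two choices differ by the stabilizer, which acts trivially on its own value.
  have key : ∀ (a₀ a₁ a : Ω) (g g' : G) (h : g • a₀ = a) (h' : g' • a₁ = a), a₀ = a₁ →
      E.conj g (hst _ _ g h) (z a₀) = E.conj g' (hst _ _ g' h') (z a₁) := by
    rintro a₀ _ _ g g' rfl h' rfl
    have hs : g⁻¹ * g' ∈ stabilizer G a₀ := by
      rw [mem_stabilizer_iff, mul_smul, h', inv_smul_smul]
    have hs' := (Subgroup.conj_smul_eq_self_of_mem hs).symm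
    rw [← E.conj_self _ _ hs hs' (z a₀), E.conj_conj _ _ hs' _
      (by rw [mul_inv_cancel_left]; exact hst _ _ g' h'), E.conj_self _ _ hs hs']
    simp only [mul_inv_cancel_left]
  refine ⟨fun a => E.conj (c a) (hst _ _ _ (hc a)) (z _), fun g a => ?_, fun a => ?_⟩
  · rw [E.conj_conj _ _ _ _ (hst _ _ (g * c a) (by rw [mul_smul, hc]))]
    refine key _ _ _ _ _ (by rw [mul_smul, hc]) (hc _) (congrArg Quotient.out ?_)
    exact Quotient.sound (s := orbitRel G Ω) ⟨g⁻¹, inv_smul_smul g a⟩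
  · rw [e.app_conj, hz]
    have : ∀ a' (h : c a • Quotient.out (Quotient.mk (orbitRel G Ω) a) = a'),
        B.conj (c a) (hst _ _ _ h) (b _) = b a' := by
      rintro _ rfl
      exact hb _ _
    exact this a (hc a)

/-- The fixed point functor of a permutation module is projective. -/
theorem projective_h0_ofMulAction [Finite G] (Ω : Type w) [Finite Ω] [MulAction G Ω] :
    Projective (h0 (Rep.ofMulAction R G Ω)) where
  factors {E B} f e he := by
    have : ∀ V : Subgroup G, Fintype (orbitRel.Quotient V Ω) := fun V => Fintype.ofFinite _
    have hb : IsEquivariantFamily B fun a => Hom.app f _ (basisElement R a) := fun g a => by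
      exact ((Hom.app_conj f g _ _).symm).trans
        (congrArg (Hom.app f _) (isEquivariantFamily_basisElement g a))
    obtain ⟨z, hz, hze⟩ := hb.exists_lift e (app_surjective_of_epi e)
    refine ⟨homOfFamily E z hz, h0_hom_ext fun a => ?_⟩
    refine Eq.trans ?_ (hze a)
    exact congrArg (Hom.app e _) (homOfFamily_basisElement hz a)

end Projective

end CohMackeyFunctor

theorem mainTheorem2 {R : Type u} [CommRing R] [IsDomain R] [IsDiscreteValuationRing R]
    [CharZero R] (p : ℕ) (hp : p.Prime)
    (hR : IsLocalRing.maximalIdeal R = Ideal.span {(p : R)})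
    {G : Type u} [Group G] [Finite G] [IsCyclic G] (hG : IsPGroup p G)
    (X : CohMackeyFunctor.{u, u, u} R G) (hX : X.IsLatticeFunctor) (h90 : X.IsHilbert90) :
    (∃ (Ω : Type u) (_ : Finite Ω) (_ : MulAction G Ω),
      Nonempty (X ≅ FixedPointFunctor.h0 (Rep.ofMulAction R G Ω))) ∧
    CategoryTheory.Projective X := by
  have hfin : Module.Finite R X.toRep := (hX ⊥).1
  have hproj : Module.Projective R X.toRep := (hX ⊥).2
  have hfree : Module.Free R X.toRep := Module.free_of_flat_of_isLocalRing
  obtain ⟨ι, _, v, hv⟩ := exists_permuted_basis hp hR hG X.toRep h90.2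
  -- The basis is indexed in `Type`, while Ω must live in the universe of R and G.
  obtain ⟨_, hact⟩ := exists_mulAction_of_permuted_basis (v.reindex Equiv.ulift.{u}.symm)
    (fun g i => by
      obtain ⟨j, hj⟩ := hv g i.down
      exact ⟨⟨j⟩, by simpa using hj⟩)
  obtain ⟨e, he⟩ := exists_equivariant_equiv_ofMulAction _ hact
  obtain ⟨i₁⟩ := h90.1.nonempty_iso_h0
  obtain ⟨i₂⟩ := CohMackeyFunctor.nonempty_h0_iso e he
  refine ⟨⟨ULift.{u} ι, inferInstance, inferInstance, ⟨i₁ ≪≫ i₂⟩⟩, ?_⟩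
  exact Projective.of_iso (i₁ ≪≫ i₂).symm (CohMackeyFunctor.projective_h0_ofMulAction _)
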